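/- **Conventions.** For a finite graph $\mathcal G$, let $\mathcal G^j$ be its $j$-subdivision (every edge is replaced by a path of $j$ edges) and let $\widetilde{\mathcal G^j}$ be $\mathcal G^j$ with each edge given, independently and uniformly at random, a letter from $\{a_1,\dots,a_m\}$ and an orientation. Let $\mathrm{fold}(\cdot)$ be the labelled directed graph obtained by performing all Stallings foldings. A *piece* in a labelled graph with no further foldings is a path without backtracking for which there is another such path reading the same word; a *non-trivial cycle* is a closed path without backtracking of positive length. The labelling satisfies $Gr'(\alpha)$, respectively $Gr'_*(\alpha)$, if every piece $p$ and every non-trivial cycle $c$ satisfy $|\ell(p)|<\alpha|\ell(c)|$, respectively $|\ell(p)|_*<\alpha|\ell(c)|_*$, where $\ell$ is the label, $|\cdot|$ is the word length in the free group on $a_1,\dots,a_m$ and $|\cdot|_*$ is the free product (syllable) length in $\langle a_1\rangle*\cdots*\langle a_m\rangle$. **Theorem A.10.** Let $m>64$ and $d$ be natural numbers, and let $C>1$ and $\alpha>0$ be real. There is a natural number $j_0=j_0(m,d,C,\alpha)>0$ such that for every natural number $j>j_0$ there are constants $a,b>0$, depending only on $m,d,C,\alpha,j$, such that the following holds. Let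 $(\mathcal S_i)_{i\in\mathbb N}$ be a sequence of finite connected simple graphs such that - $3\le\deg(v)\le d$ for all vertices $v$ of all $\mathcal S_i$, - $\mathrm{girth}(\mathcal S_i)\to\infty$ as $i\to\infty$, - $\mathrm{diam}(\mathcal S_i)\le C\,\mathrm{girth}(\mathcal S_i)$ for all $i$. Then the probability $P_i$ that the labelling of $\mathrm{fold}(\widetilde{\mathcal S_i^j})$ satisfies both $Gr'_*(\alpha)$ over $\langle a_1\rangle*\cdots*\langle a_m\rangle$ and $Gr'(\alpha)$ in the free group on $a_1,\dots,a_m$ tends to $1$ as $i\to\infty$, exponentially in the girth: $$P_i\ \ge\ 1-a\,e^{-b\,\mathrm{girth}(\mathcal S_i)}\qquad\text{for all } i.$$ -/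

import Mathlib

/-!
Labelled directed graphs, Stallings folding, graphical small cancellation conditions,
randomly labelled subdivisions of graphs.
-/

/-- A directed graph with vertex set `V` whose edges are labelled by letters from `L`:
`Edge u a v` says that there is an edge from `u` to `v` with label `a`.  Loops are allowed, and
so are several edges between two vertices, as long as they differ in label or direction. -/
structure LabeledGraph (V L : Type*) where
  /-- `Edge u a v`: there is an edge from `u` to `v` with label `a`. -/
  Edge : V → L → V → Prop

namespace LabeledGraph

variable {V L : Type*}

/-- The labelling is reduced: no two distinct edges with the same label start at the same vertex,
and no two distinct edges with the same label end at the same vertex. -/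
def IsReduced (Γ : LabeledGraph V L) : Prop :=
  (∀ (a : L) (u v v' : V), Γ.Edge u a v → Γ.Edge u a v' → v = v') ∧
  (∀ (a : L) (u u' v : V), Γ.Edge u a v → Γ.Edge u' a v → u = u')

/-- The identifications of vertices that are forced by folding: the smallest equivalence relation
such that two edges with the same label and identified initial vertices have identified terminal
vertices, and vice versa. -/
inductive FoldRel (Γ : LabeledGraph V L) : V → V → Prop
  | refl (u : V) : FoldRel Γ u u
  | symm {u v : V} : FoldRel Γ u v → FoldRel Γ v u
  | trans {u v w : V} : FoldRel Γ u v → FoldRel Γ v w → FoldRel Γ u w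
  | forward {a : L} {u v u' v' : V} :
      Γ.Edge u a v → Γ.Edge u' a v' → FoldRel Γ u u' → FoldRel Γ v v'
  | backward {a : L} {u v u' v' : V} :
      Γ.Edge u a v → Γ.Edge u' a v' → FoldRel Γ v v' → FoldRel Γ u u'

/-- The equivalence relation on vertices given by folding. -/
def foldSetoid (Γ : LabeledGraph V L) : Setoid V where
  r := Γ.FoldRel
  iseqv := ⟨FoldRel.refl, FoldRel.symm, FoldRel.trans⟩

/-- The folded graph: the result of performing all possible Stallings foldings. -/
def fold (Γ : LabeledGraph V L) : LabeledGraph (Quotient Γ.foldSetoid) L where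
  Edge x a y := ∃ u v : V, Γ.Edge u a v ∧
    Quotient.mk Γ.foldSetoid u = x ∧ Quotient.mk Γ.foldSetoid v = y

/-- The folded graph admits no further foldings. -/
theorem fold_isReduced (Γ : LabeledGraph V L) : Γ.fold.IsReduced := by
  constructor
  · rintro a x y y' ⟨u, v, h, hu, rfl⟩ ⟨u', v', h', hu', rfl⟩
    exact Quotient.sound (s := Γ.foldSetoid)
      (FoldRel.forward h h' (Quotient.exact (s := Γ.foldSetoid) (hu.trans hu'.symm)))
  · rintro a x x' y ⟨u, v, h, rfl, hv⟩ ⟨u', v', h', rfl, hv'⟩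
    exact Quotient.sound (s := Γ.foldSetoid)
      (FoldRel.backward h h' (Quotient.exact (s := Γ.foldSetoid) (hv.trans hv'.symm)))

/-- `Step u (a, true) v`: an edge labelled `a` is traversed from `u` to `v` in its direction.
`Step u (a, false) v`: an edge labelled `a` is traversed from `u` to `v` against its direction,
reading the inverse of `a`. -/
def Step (Γ : LabeledGraph V L) (u : V) (s : L × Bool) (v : V) : Prop :=
  if s.2 then Γ.Edge u s.1 v else Γ.Edge v s.1 u

/-- The list of steps (signed letter that is read, vertex that is reached) can be walked in `Γ`
from `u`. -/
def IsWalk (Γ : LabeledGraph V L) : V → List ((L × Bool) × V) → Prop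
  | _, [] => True
  | u, (s, v) :: l => Γ.Step u s v ∧ IsWalk Γ v l

/-- No edge is traversed and then immediately traversed back. -/
def NoBacktracking : V → List ((L × Bool) × V) → Prop
  | _, [] => True
  | _, [_] => True
  | u, (s, v) :: (t, w) :: l =>
      ¬ (t = (s.1, !s.2) ∧ w = u) ∧ NoBacktracking v ((t, w) :: l)

/-- A reduced path in `Γ`: a path without backtracking.  A path is given by its initial vertex and
its list of steps. -/
@[ext]
structure ReducedPath (Γ : LabeledGraph V L) where
  /-- the initial vertex -/
  start : V
  /-- the signed letters that are read and the vertices that are reached, in order -/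
  steps : List ((L × Bool) × V)
  isWalk : Γ.IsWalk start steps
  noBacktracking : NoBacktracking start steps

namespace ReducedPath

variable {Γ : LabeledGraph V L}

/-- The word in the letters and their inverses that is read on a path. -/
def word (p : Γ.ReducedPath) : List (L × Bool) := p.steps.map Prod.fst

/-- The label of a path, as an element of the free group. -/
def label (p : Γ.ReducedPath) : FreeGroup L := FreeGroup.mk p.word

/-- The terminal vertex of a path. -/
def finish (p : Γ.ReducedPath) : V := p.steps.foldl (fun _ s => s.2) p.start

/-- Non-trivial cycles: closed reduced paths of positive length. -/
def IsNontrivialCycle (p : Γ.ReducedPath) : Prop := p.steps ≠ [] ∧ p.finish = p.start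

/-- A piece: a labelled reduced path with at least two distinct immersions into `Γ`, that is, there
is another reduced path in `Γ` on which the same word is read. -/
def IsPiece (p : Γ.ReducedPath) : Prop := ∃ q : Γ.ReducedPath, q ≠ p ∧ q.word = p.word

end ReducedPath

/-- The graphical small cancellation condition with parameter `α` with respect to a length function
`len` on the free group: the labelling is reduced, and every piece has length less than `α` times
the length of each non-trivial cycle (that is, less than `α` times the minimum of these lengths,
which is infinite if there are no non-trivial cycles). -/
def SmallCancellation (Γ : LabeledGraph V L) (len : FreeGroup L → ℕ) (α : ℝ) : Prop :=
  Γ.IsReduced ∧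
  ∀ p : Γ.ReducedPath, p.IsPiece → ∀ c : Γ.ReducedPath, c.IsNontrivialCycle →
    (len p.label : ℝ) < α * (len c.label : ℝ)

/-- The free product length (syllable length) over the free product of the infinite cyclic groups
generated by the letters: the number of factors of the normal form. -/
def freeProductLength [DecidableEq L] (x : FreeGroup L) : ℕ :=
  (Monoid.CoprodI.Word.equiv (freeGroupEquivCoprodI x)).toList.length

/-- The `Gr'(α)` small cancellation condition, with respect to the word length metric of the free
group. -/
def Gr [DecidableEq L] (Γ : LabeledGraph V L) (α : ℝ) : Prop :=
  Γ.SmallCancellation FreeGroup.norm α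

/-- The `Gr'_*(α)` small cancellation condition, with respect to the free product length over the
free product of the infinite cyclic groups generated by the letters. -/
def GrStar [DecidableEq L] (Γ : LabeledGraph V L) (α : ℝ) : Prop :=
  Γ.SmallCancellation freeProductLength α

end LabeledGraph

/-! ### Randomly labelled subdivisions -/

/-- Vertices of the `j`-subdivision (`1 ≤ j`): the old vertices, and `j - 1` new vertices on each
old edge. -/
abbrev SubdivVertex {V : Type*} (G : SimpleGraph V) (j : ℕ) : Type _ :=
  V ⊕ (G.edgeSet × Fin (j - 1))

/-- Edges of the `j`-subdivision: `j` edges for each old edge. -/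
abbrev SubdivEdge {V : Type*} (G : SimpleGraph V) (j : ℕ) : Type _ := G.edgeSet × Fin j

/-- The `k`-th vertex, `0 ≤ k ≤ j`, on the path of length `j` that replaces the edge `e`; the path
runs from one endpoint of `e` to the other, in a direction that is chosen for each `e`.  The `k`-th
edge of this path, `0 ≤ k < j`, joins the `k`-th vertex to the vertex number `k + 1`. -/
noncomputable def subdivPoint {V : Type*} (G : SimpleGraph V) (j : ℕ) (e : G.edgeSet) (k : ℕ) :
    SubdivVertex G j :=
  if k = 0 then Sum.inl (Quot.out e.1).1
  else if h : k - 1 < j - 1 then Sum.inr (e, ⟨k - 1, h⟩)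
  else Sum.inl (Quot.out e.1).2

/-- A labelling of the `j`-subdivision by `{a_1, …, a_m} × {±1}`: a letter and an orientation for
each edge of the subdivision. -/
abbrev SubdivLabeling {V : Type*} (G : SimpleGraph V) (j m : ℕ) : Type _ :=
  SubdivEdge G j → Fin m × Bool

/-- The directed labelled graph given by a labelling of the `j`-subdivision of `G`: an edge with
sign `true` is directed as the path that contains it, one with sign `false` is directed the other
way. -/
def labeledSubdivision {V : Type*} (G : SimpleGraph V) (j m : ℕ) (ω : SubdivLabeling G j m) :
    LabeledGraph (SubdivVertex G j) (Fin m) where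
  Edge u a v := ∃ (e : G.edgeSet) (k : Fin j),
    (ω (e, k) = (a, true) ∧ u = subdivPoint G j e k ∧ v = subdivPoint G j e (k + 1)) ∨
    (ω (e, k) = (a, false) ∧ u = subdivPoint G j e (k + 1) ∧ v = subdivPoint G j e k)

/-- The probability of an event for a uniformly random element of a finite type. -/
noncomputable def uniformProb (Ω : Type*) (A : Set Ω) : ℝ := (A.ncard : ℝ) / (Nat.card Ω : ℝ)

/-- The probability that the folding of the uniformly randomly labelled `j`-subdivision of `G`
satisfies both small cancellation conditions with parameter `α`. -/
noncomputable def probGrStarAndGr {V : Type*} (G : SimpleGraph V) (j m : ℕ) (α : ℝ) : ℝ :=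
  uniformProb (SubdivLabeling G j m)
    {ω | (labeledSubdivision G j m ω).fold.GrStar α ∧ (labeledSubdivision G j m ω).fold.Gr α}

/-- A sequence of finite connected graphs with all degrees between `3` and `d`, girth tending to
infinity, and diameter at most `C` times the girth.  (No spectral gap is required.) -/
structure IsSelbergFamily (d : ℕ) (C : ℝ) {V : ℕ → Type*} (S : ∀ i, SimpleGraph (V i)) : Prop where
  finite : ∀ i, Finite (V i)
  connected : ∀ i, (S i).Connected
  three_le_degree : ∀ i (v : V i), 3 ≤ ((S i).neighborSet v).ncard
  degree_le : ∀ i (v : V i), ((S i).neighborSet v).ncard ≤ d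
  girth_tendsto : Filter.Tendsto (fun i => (S i).girth) Filter.atTop Filter.atTop
  diam_le : ∀ i, ((S i).diam : ℝ) ≤ C * ((S i).girth : ℝ)

/-!
Every piece `p` and every non-trivial cycle `c` of the folded graph satisfy `|p| < α |c|_*` with
high probability, where `|·|` is the word length and `|·|_*` is the syllable length. As
`|·|_* ≤ |·|`, this inequality contains both small cancellation conditions.

*Scale.* Let `g` be the girth of `S`. The lengths that matter are multiples of `T = t * g`, where
`t` is a small fixed proportion of `j`. Closed walks of length less than `g * j` in the subdivision
are null-homotopic (`subdivNaming_trivialBelow`), so paths of length a bounded multiple of `T` are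
determined by their endpoints, and any two walks of such lengths with the same endpoints carry the
same element of the free group. By the bound on the diameter, the subdivision has at most
`j * exp (O (g))` vertices, where the constant does not depend on `j`, whereas the exceptional events below
have probability at most `(2 / 3) ^ T`. If `j` is large, a union bound over pairs and quadruples of
endpoints therefore loses nothing.

*Probability.* When a product of independent random letters grows by one letter, its syllable length
increases by one unless the new letter belongs to one particular generator, so the expectation of
`4 ^ (-|·|_*)` is contracted by a constant factor (`sum_weight_signedProd_le`, also for conjugation by
random letters). Consequently, with high probability

* each path whose length lies between `T` and a large multiple of `T` has a label of syllable length
  at least half its length (`uniformProb_label_short_le`);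
* two paths of length at least `10 T` carry the same label only if their starting points are joined
  by a path with trivial label (`TrivialBelow.uniformProb_label_eq_le`). In the tree-like situation
  at hand the two paths have at most one common segment; if that leaves a long segment covered once,
  its label is determined by the others, and otherwise the common segment conjugates a short element
  to a short one, or its label is a square root of a given element up to a given factor.

*Folding.* These properties imply small cancellation (`Represents.gr_fold`). Identified vertices are
joined by a path of length at most `T` with trivial label, by induction on the generation of the
relation: a step at most doubles the length, roughly, and there are no paths with trivial label
whose length lies between `T` and a large multiple of `T`. By the same continuity argument, a path
of length `n` in the folded graph, with `n` in the range considered, comes from a path in the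
subdivision of length at most `max T (2 n)` with the same label. Hence a short non-trivial cycle
would give a closed walk with non-trivial label shorter than `g * j`; long cycles have long labels
because of their terminal segments; and pieces of length `10 T` are excluded by the second property.
-/

/-! ### Syllable length in the free group -/

namespace LabeledGraph

open Monoid Monoid.CoprodI

variable {L : Type*}

/-- A letter, as an element of the cyclic free factor that it generates. -/
def syllable (s : L × Bool) : FreeGroup Unit := FreeGroup.mk [((), s.2)]

theorem syllable_pow_ne_one (s : L × Bool) {k : ℕ} (hk : k ≠ 0) : syllable s ^ k ≠ 1 := by
  rw [Ne, pow_eq_one_iff_left hk]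
  intro h
  have := congrArg FreeGroup.toWord h
  simp [syllable, FreeGroup.toWord_mk] at this

theorem syllable_ne_one (s : L × Bool) : syllable s ≠ 1 := by
  simpa using syllable_pow_ne_one s one_ne_zero

theorem freeGroupEquivCoprodI_mk_singleton (s : L × Bool) :
    freeGroupEquivCoprodI (FreeGroup.mk [s]) = of (M := fun _ : L => FreeGroup Unit) (i := s.1)
      (syllable s) := by
  obtain ⟨a, b⟩ := s
  have h : ∀ a : L, freeGroupEquivCoprodI (FreeGroup.mk [(a, true)]) =
      of (M := fun _ : L => FreeGroup Unit) (i := a) (FreeGroup.mk [((), true)]) := by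
    intro a
    change freeGroupEquivCoprodI (FreeGroup.of a) = _
    rw [freeGroupEquivCoprodI_apply, FreeGroup.lift_apply_of]
    rfl
  cases b
  · have h1 : (FreeGroup.mk [(a, false)]) = (FreeGroup.mk [(a, true)])⁻¹ := by
      simp [FreeGroup.inv_mk, FreeGroup.invRev]
    have h2 : syllable (a, false) = (FreeGroup.mk [((), true)])⁻¹ := by
      simp [syllable, FreeGroup.inv_mk, FreeGroup.invRev]
    rw [h1, h2, map_inv, map_inv, h a]
  · exact h a

/-- The normal form of an element of the free group in the free product of the cyclic groups
generated by the letters. -/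
def normalForm [DecidableEq L] (x : FreeGroup L) : Word (fun _ : L => FreeGroup Unit) :=
  Word.equiv (freeGroupEquivCoprodI x)

theorem length_rcons {i : L} (p : Word.Pair (fun _ : L => FreeGroup Unit) i) :
    (Word.rcons p).toList.length = p.tail.toList.length + if p.head = 1 then 0 else 1 := by
  unfold Word.rcons
  split_ifs <;> simp

theorem inv_mk_singleton (s : L × Bool) :
    (FreeGroup.mk [s])⁻¹ = FreeGroup.mk [(s.1, !s.2)] := by
  simp [FreeGroup.inv_mk, FreeGroup.invRev]

theorem length_neWord_inv {i j : L} (w : NeWord (fun _ : L => FreeGroup Unit) i j) :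
    w.inv.toList.length = w.toList.length := by
  induction w with
  | singleton => rfl
  | append w₁ _ w₂ h₁ h₂ =>
    simp only [NeWord.inv, NeWord.toList, List.length_append, h₁, h₂]
    omega

variable [DecidableEq L]

theorem freeProductLength_eq (x : FreeGroup L) :
    freeProductLength x = (normalForm x).toList.length := rfl

theorem normalForm_one : normalForm (1 : FreeGroup L) = Word.empty := by
  simp [normalForm, Word.equiv]

@[simp]
theorem freeProductLength_one : freeProductLength (1 : FreeGroup L) = 0 := by
  simp [freeProductLength_eq, normalForm_one]

theorem normalForm_mk_singleton_mul (s : L × Bool) (x : FreeGroup L) :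
    normalForm (FreeGroup.mk [s] * x) =
      Word.rcons (⟨syllable s * (Word.equivPair s.1 (normalForm x)).head,
        (Word.equivPair s.1 (normalForm x)).tail,
        (Word.equivPair s.1 (normalForm x)).fstIdx_ne⟩ :
        Word.Pair (fun _ : L => FreeGroup Unit) s.1) := by
  simp only [normalForm, Word.equiv, Equiv.coe_fn_mk, map_mul, mul_smul]
  rw [freeGroupEquivCoprodI_mk_singleton]
  exact Word.of_smul_def _ _ _

theorem equivPair_head_normalForm_mk_singleton_mul (s : L × Bool) (x : FreeGroup L) :
    (Word.equivPair s.1 (normalForm (FreeGroup.mk [s] * x))).head =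
      syllable s * (Word.equivPair s.1 (normalForm x)).head := by
  rw [normalForm_mk_singleton_mul, ← Word.equivPair_symm, Equiv.apply_symm_apply]

theorem freeProductLength_eq_equivPair (i : L) (x : FreeGroup L) :
    freeProductLength x = (Word.equivPair i (normalForm x)).tail.toList.length +
      if (Word.equivPair i (normalForm x)).head = 1 then 0 else 1 := by
  rw [← length_rcons, freeProductLength_eq]
  congr 2
  exact ((Word.equivPair i).symm_apply_apply _).symm

theorem freeProductLength_mk_singleton_mul (s : L × Bool) (x : FreeGroup L) :
    freeProductLength (FreeGroup.mk [s] * x) =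
      (Word.equivPair s.1 (normalForm x)).tail.toList.length +
      if syllable s * (Word.equivPair s.1 (normalForm x)).head = 1 then 0 else 1 := by
  rw [freeProductLength_eq, normalForm_mk_singleton_mul, length_rcons]

theorem freeProductLength_mk_singleton_mul_le (s : L × Bool) (x : FreeGroup L) :
    freeProductLength (FreeGroup.mk [s] * x) ≤ freeProductLength x + 1 := by
  rw [freeProductLength_mk_singleton_mul, freeProductLength_eq_equivPair s.1]
  split_ifs <;> omega

theorem freeProductLength_le_mk_singleton_mul (s : L × Bool) (x : FreeGroup L) :
    freeProductLength x ≤ freeProductLength (FreeGroup.mk [s] * x) + 1 := by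
  have := freeProductLength_mk_singleton_mul_le (s.1, !s.2) (FreeGroup.mk [s] * x)
  rwa [← inv_mk_singleton, inv_mul_cancel_left] at this

/-- Multiplication by a letter other than the one in the first syllable creates a new syllable. -/
theorem exists_freeProductLength_mk_singleton_mul_eq (x : FreeGroup L) :
    ∃ i : Option L, ∀ s : L × Bool, some s.1 ≠ i →
      freeProductLength (FreeGroup.mk [s] * x) = freeProductLength x + 1 := by
  refine ⟨(normalForm x).fstIdx, fun s hs => ?_⟩
  rw [freeProductLength_mk_singleton_mul, Word.equivPair_eq_of_fstIdx_ne hs.symm,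
    freeProductLength_eq, if_neg]
  simpa using syllable_ne_one s

theorem freeProductLength_neWord {i j : L} (w : NeWord (fun _ : L => FreeGroup Unit) i j)
    (x : FreeGroup L) (hx : freeGroupEquivCoprodI x = w.prod) :
    freeProductLength x = w.toList.length := by
  have : normalForm x = w.toWord := by
    rw [normalForm, hx]
    exact Word.equiv.apply_symm_apply _
  rw [freeProductLength_eq, this]
  rfl

theorem exists_neWord {x : FreeGroup L} (hx : x ≠ 1) :
    ∃ (i j : L) (w : NeWord (fun _ : L => FreeGroup Unit) i j),
      freeGroupEquivCoprodI x = w.prod := by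
  have h : normalForm x ≠ Word.empty := by
    rw [← normalForm_one]
    intro h
    exact hx (freeGroupEquivCoprodI.injective (Word.equiv.injective h))
  obtain ⟨i, j, w, hw⟩ := NeWord.of_word _ h
  refine ⟨i, j, w, ?_⟩
  have := Word.equiv.symm_apply_apply (freeGroupEquivCoprodI x)
  rw [← this]
  change Word.prod (normalForm x) = w.prod
  rw [← hw]
  rfl

theorem freeProductLength_inv (x : FreeGroup L) :
    freeProductLength x⁻¹ = freeProductLength x := by
  by_cases hx : x = 1
  · simp [hx]
  obtain ⟨i, j, w, hw⟩ := exists_neWord hx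
  rw [freeProductLength_neWord w x hw, freeProductLength_neWord w.inv x⁻¹, length_neWord_inv]
  rw [map_inv, hw, NeWord.inv_prod]

/-- Conjugation by a letter other than the ones in the first and the last syllable creates two new
syllables. -/
theorem exists_freeProductLength_conj_eq {x : FreeGroup L} (hx : x ≠ 1) :
    ∃ i k : L, ∀ s : L × Bool, s.1 ≠ i → s.1 ≠ k →
      freeProductLength (FreeGroup.mk [s] * x * (FreeGroup.mk [s])⁻¹) =
        freeProductLength x + 2 := by
  obtain ⟨i, k, w, hw⟩ := exists_neWord hx
  refine ⟨i, k, fun s hi hk => ?_⟩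
  rw [freeProductLength_neWord w x hw]
  rw [freeProductLength_neWord (((NeWord.singleton (M := fun _ : L => FreeGroup Unit) (i := s.1)
    (syllable s) (syllable_ne_one s)).append hi w).append hk.symm
    (NeWord.singleton (M := fun _ : L => FreeGroup Unit) (i := s.1)
    (syllable s)⁻¹ (inv_ne_one.2 (syllable_ne_one s))))]
  · simp [NeWord.toList]
  · rw [map_mul, map_mul, map_inv, freeGroupEquivCoprodI_mk_singleton, hw]
    simp

theorem freeProductLength_le_conj (s : L × Bool) (x : FreeGroup L) :
    freeProductLength x ≤
      freeProductLength (FreeGroup.mk [s] * x * (FreeGroup.mk [s])⁻¹) + 2 := by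
  have h1 := freeProductLength_le_mk_singleton_mul s x
  have h2 := freeProductLength_le_mk_singleton_mul s (FreeGroup.mk [s] * x)⁻¹
  have h3 : FreeGroup.mk [s] * (FreeGroup.mk [s] * x)⁻¹ =
      (FreeGroup.mk [s] * x * (FreeGroup.mk [s])⁻¹)⁻¹ := by group
  rw [h3, freeProductLength_inv, freeProductLength_inv] at h2
  omega

theorem freeProductLength_mk_le (w : List (L × Bool)) :
    freeProductLength (FreeGroup.mk w) ≤ w.length := by
  induction w with
  | nil => exact freeProductLength_one.le
  | cons s w ih =>
    have h := freeProductLength_mk_singleton_mul_le s (FreeGroup.mk w)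
    rw [FreeGroup.mul_mk, List.singleton_append] at h
    simp only [List.length_cons]
    omega

theorem freeProductLength_le_norm (x : FreeGroup L) : freeProductLength x ≤ x.norm := by
  have := freeProductLength_mk_le x.toWord
  rwa [FreeGroup.mk_toWord] at this

/-- The first syllable of the normal form of a reduced word is a positive power of its first
letter. -/
theorem equivPair_head_normalForm_of_isReduced (s : L × Bool) (w : List (L × Bool))
    (h : FreeGroup.IsReduced (s :: w)) :
    ∃ k : ℕ, k ≠ 0 ∧ (Word.equivPair s.1 (normalForm (FreeGroup.mk (s :: w)))).head =
      syllable s ^ k := by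
  induction w generalizing s with
  | nil =>
    refine ⟨1, one_ne_zero, ?_⟩
    have := equivPair_head_normalForm_mk_singleton_mul s 1
    rw [normalForm_one, Word.equivPair_eq_of_fstIdx_ne (w := Word.empty) (by simp [Word.fstIdx]),
      mul_one] at this
    rw [this]
    simp
  | cons t w ih =>
    rw [FreeGroup.isReduced_cons_cons] at h
    obtain ⟨k, hk, hk'⟩ := ih t h.2
    have key := equivPair_head_normalForm_mk_singleton_mul s (FreeGroup.mk (t :: w))
    rw [FreeGroup.mul_mk, List.singleton_append] at key
    rw [key]
    by_cases hst : s.1 = t.1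
    · obtain rfl : s = t := Prod.ext hst (h.1 hst)
      exact ⟨k + 1, Nat.succ_ne_zero k, by simp [hk', pow_succ']⟩
    · refine ⟨1, one_ne_zero, ?_⟩
      have hidx : (normalForm (FreeGroup.mk (t :: w))).fstIdx ≠ some s.1 := by
        intro hidx
        have h1 := Word.equivPair_eq_of_fstIdx_ne (i := t.1)
          (w := normalForm (FreeGroup.mk (t :: w))) (by rw [hidx]; simpa using hst)
        rw [h1] at hk'
        exact syllable_pow_ne_one t hk hk'.symm
      rw [Word.equivPair_eq_of_fstIdx_ne hidx]
      simp

theorem freeProductLength_mk_le_mk_cons (s : L × Bool) (w : List (L × Bool))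
    (h : FreeGroup.IsReduced (s :: w)) :
    freeProductLength (FreeGroup.mk w) ≤ freeProductLength (FreeGroup.mk (s :: w)) := by
  obtain ⟨k, hk, hk'⟩ := equivPair_head_normalForm_of_isReduced s w h
  have key := equivPair_head_normalForm_mk_singleton_mul s (FreeGroup.mk w)
  have e : FreeGroup.mk [s] * FreeGroup.mk w = FreeGroup.mk (s :: w) := by
    rw [FreeGroup.mul_mk, List.singleton_append]
  rw [e] at key
  rw [key] at hk'
  have := freeProductLength_mk_singleton_mul s (FreeGroup.mk w)
  rw [e] at this
  rw [this, freeProductLength_eq_equivPair s.1, if_neg (c := syllable s * _ = 1)]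
  · split_ifs <;> omega
  · rw [hk']
    exact syllable_pow_ne_one s hk

/-- In the free product, as in the free group, the suffixes of a reduced word are not longer than
the word. -/
theorem freeProductLength_mk_le_mk_append (w₁ w₂ : List (L × Bool))
    (h : FreeGroup.IsReduced (w₁ ++ w₂)) :
    freeProductLength (FreeGroup.mk w₂) ≤ freeProductLength (FreeGroup.mk (w₁ ++ w₂)) := by
  induction w₁ with
  | nil => exact le_rfl
  | cons s w₁ ih =>
    exact (ih (h.infix ⟨[s], [], by simp⟩)).trans (freeProductLength_mk_le_mk_cons s _ h)

end LabeledGraph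

/-! ### Uniform probabilities and products of independent letters -/

theorem uniformProb_le_of_sum_le {Ω : Type*} [Fintype Ω] (X : Set Ω) (F : Ω → ℝ) (c : ℝ)
    (hX : ∀ ω ∈ X, 1 ≤ F ω) (h0 : ∀ ω, 0 ≤ F ω) (hc : 0 ≤ c)
    (hF : ∑ ω, F ω ≤ c * (Fintype.card Ω : ℝ)) : uniformProb Ω X ≤ c := by
  classical
  unfold uniformProb
  rw [Nat.card_eq_fintype_card]
  refine div_le_of_le_mul₀ (Nat.cast_nonneg _) hc (le_trans ?_ hF)
  rw [Set.ncard_eq_toFinset_card', Finset.card_eq_sum_ones, Nat.cast_sum]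
  refine (Finset.sum_le_sum fun ω hω => ?_).trans
    (Finset.sum_le_univ_sum_of_nonneg (s := X.toFinset) h0)
  simpa using hX ω (by simpa using hω)

theorem uniformProb_nonneg {Ω : Type*} (X : Set Ω) : 0 ≤ uniformProb Ω X := by
  unfold uniformProb; positivity

theorem uniformProb_mono {Ω : Type*} [Finite Ω] {X Y : Set Ω} (h : X ⊆ Y) :
    uniformProb Ω X ≤ uniformProb Ω Y := by
  unfold uniformProb
  gcongr
  exact Y.toFinite

theorem uniformProb_union_le {Ω : Type*} (X Y : Set Ω) :
    uniformProb Ω (X ∪ Y) ≤ uniformProb Ω X + uniformProb Ω Y := by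
  unfold uniformProb
  rw [← add_div]
  gcongr
  exact_mod_cast Set.ncard_union_le X Y

theorem uniformProb_iUnion_le {Ω ι : Type*} [Finite Ω] [Fintype ι] (X : ι → Set Ω) (c : ℝ)
    (h : ∀ i, uniformProb Ω (X i) ≤ c) :
    uniformProb Ω (⋃ i, X i) ≤ Fintype.card ι * c := by
  classical
  have key : ∀ s : Finset ι, uniformProb Ω (⋃ i ∈ s, X i) ≤ s.card * c := by
    intro s
    induction s using Finset.induction_on with
    | empty => simp [uniformProb]
    | insert a s ha ih =>
      rw [Finset.set_biUnion_insert, Finset.card_insert_of_notMem ha]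
      have := uniformProb_union_le (X a) (⋃ i ∈ s, X i)
      push_cast
      linarith [h a]
  simpa using key Finset.univ

theorem uniformProb_compl {Ω : Type*} [Finite Ω] [Nonempty Ω] (X : Set Ω) :
    uniformProb Ω Xᶜ = 1 - uniformProb Ω X := by
  unfold uniformProb
  have h := Set.ncard_add_ncard_compl X
  have h0 : (Nat.card Ω : ℝ) ≠ 0 := by exact_mod_cast Nat.card_pos.ne'
  rw [eq_sub_iff_add_eq, ← add_div, div_eq_one_iff_eq h0]
  rw [add_comm]
  exact_mod_cast h

theorem uniformProb_le_one {Ω : Type*} [Finite Ω] (X : Set Ω) : uniformProb Ω X ≤ 1 := by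
  unfold uniformProb
  refine div_le_one_of_le₀ ?_ (Nat.cast_nonneg _)
  exact_mod_cast Set.ncard_le_card X

/-- Resampling one coordinate does not change averages. -/
theorem sum_sum_update {E A : Type*} [Fintype E] [DecidableEq E] [Fintype A] (e : E)
    (F : (E → A) → ℝ) :
    ∑ ω, ∑ a, F (Function.update ω e a) = Fintype.card A * ∑ ω, F ω := by
  rw [← Fintype.sum_prod_type']
  have : ∑ x : (E → A) × A, F (Function.update x.1 e x.2) = ∑ x : (E → A) × A, F x.1 := by
    refine Finset.sum_bij' (fun x _ => (Function.update x.1 e x.2, x.1 e))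
      (fun x _ => (Function.update x.1 e x.2, x.1 e)) ?_ ?_ ?_ ?_ ?_ <;> simp
  rw [this, Fintype.sum_prod_type]
  simp [Finset.mul_sum]

theorem sum_le_of_sum_update_le {E A : Type*} [Fintype E] [DecidableEq E] [Fintype A] [Nonempty A]
    (e : E) (F G : (E → A) → ℝ) (c : ℝ)
    (h : ∀ ω, ∑ a, F (Function.update ω e a) ≤ c * Fintype.card A * G ω) :
    ∑ ω, F ω ≤ c * ∑ ω, G ω := by
  have h1 := sum_sum_update e F
  have h2 : ∑ ω, ∑ a, F (Function.update ω e a) ≤ ∑ ω, c * Fintype.card A * G ω :=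
    Finset.sum_le_sum fun ω _ => h ω
  rw [h1, ← Finset.mul_sum, mul_comm c, mul_assoc] at h2
  exact le_of_mul_le_mul_left h2 (by exact_mod_cast Fintype.card_pos)

/-- The value of a list of signed edges under a labelling of the edges by elements of a group. -/
def signedProd {E G : Type*} [Group G] (f : E → G) (l : List (E × Bool)) : G :=
  (l.map fun x => if x.2 then f x.1 else (f x.1)⁻¹).prod

section signedProd

variable {E G : Type*} [Group G] (f : E → G)

@[simp]
theorem signedProd_nil : signedProd f [] = 1 := rfl

theorem signedProd_cons (x : E × Bool) (l : List (E × Bool)) :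
    signedProd f (x :: l) = (if x.2 then f x.1 else (f x.1)⁻¹) * signedProd f l := by
  simp [signedProd]

theorem signedProd_append (l l' : List (E × Bool)) :
    signedProd f (l ++ l') = signedProd f l * signedProd f l' := by
  simp [signedProd]

theorem signedProd_congr {f g : E → G} {l : List (E × Bool)} (h : ∀ e ∈ l.map Prod.fst, f e = g e) :
    signedProd f l = signedProd g l := by
  unfold signedProd
  congr 1
  refine List.map_congr_left fun x hx => ?_
  rw [h x.1 (List.mem_map_of_mem hx)]

end signedProd

/-- The labelling of the edges by elements of the free group that is given by a labelling by
letters and signs. -/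
def freeLabel {E : Type*} {m : ℕ} (ω : E → Fin m × Bool) (e : E) : FreeGroup (Fin m) :=
  FreeGroup.mk [ω e]

section moments

variable {E : Type*} [Fintype E] [DecidableEq E] {m : ℕ}

/-- Let the free group act on `Z`, and let a random letter contract a weight `Λ` by a factor `ρ` on
average.  Then a product of `n` independent random letters contracts it by a factor `ρ ^ n`, also
if it is applied to a random point `h`, provided that `h` is independent of these letters. -/
theorem sum_weight_signedProd_le [NeZero m] {Z : Type*} (φ : FreeGroup (Fin m) →* Equiv.Perm Z)
    (Λ : Z → ℝ) (ρ : ℝ) (hρ : 0 ≤ ρ)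
    (hΛ : ∀ z, ∑ s : Fin m × Bool, Λ (φ (FreeGroup.mk [s]) z) ≤ ρ * (2 * m) * Λ z)
    (l : List (E × Bool)) (hl : (l.map Prod.fst).Nodup) (h : (E → Fin m × Bool) → Z)
    (hh : ∀ e ∈ l.map Prod.fst, ∀ ω s, h (Function.update ω e s) = h ω) :
    ∑ ω, Λ (φ (signedProd (freeLabel ω) l) (h ω)) ≤ ρ ^ l.length * ∑ ω, Λ (h ω) := by
  induction l with
  | nil => simp
  | cons x l ih =>
    simp only [List.map_cons, List.nodup_cons] at hl
    have ih' := ih hl.2 fun e he => hh e (List.mem_cons_of_mem _ he)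
    rw [List.length_cons, pow_succ', mul_assoc]
    refine le_trans ?_ (mul_le_mul_of_nonneg_left ih' hρ)
    refine sum_le_of_sum_update_le x.1 _ _ ρ fun ω => ?_
    have hcard : (Fintype.card (Fin m × Bool) : ℝ) = 2 * m := by
      simp [mul_comm]
    rw [hcard]
    have hrest : ∀ s, signedProd (freeLabel (Function.update ω x.1 s)) l =
        signedProd (freeLabel ω) l := by
      intro s
      refine signedProd_congr fun e he => ?_
      have : e ≠ x.1 := fun h' => hl.1 (h' ▸ he)
      simp [freeLabel, this]
    have hx : ∀ s, h (Function.update ω x.1 s) = h ω := hh x.1 (by simp) ω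
    simp only [signedProd_cons, hrest, hx, map_mul, Equiv.Perm.mul_apply]
    set z := φ (signedProd (freeLabel ω) l) (h ω)
    have hself : ∀ s, freeLabel (Function.update ω x.1 s) x.1 = FreeGroup.mk [s] := by
      intro s; simp [freeLabel]
    simp only [hself]
    cases x.2
    · -- Traversing the edge against its direction: the inverse of a uniform letter is uniform.
      have hinv : ∀ s : Fin m × Bool, (FreeGroup.mk [s])⁻¹ =
          FreeGroup.mk [((Equiv.refl (Fin m)).prodCongr Equiv.boolNot) s] :=
        fun s => LabeledGraph.inv_mk_singleton s
      simp only [Bool.false_eq_true, if_false, hinv]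
      rw [Equiv.sum_comp ((Equiv.refl (Fin m)).prodCongr Equiv.boolNot)
        fun s => Λ (φ (FreeGroup.mk [s]) z)]
      exact hΛ z
    · simpa using hΛ z

theorem sum_letters_le (F : Fin m × Bool → ℝ) (S : Finset (Fin m)) (A B : ℝ) (hA0 : 0 ≤ A)
    (hA : ∀ s, s.1 ∉ S → F s ≤ A) (hB : ∀ s, F s ≤ B) :
    ∑ s, F s ≤ 2 * m * A + 2 * S.card * B := by
  have h : ∀ s, F s ≤ A + if s.1 ∈ S then B else 0 := by
    intro s
    split_ifs with hs
    · linarith [hB s]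
    · linarith [hA s hs]
  refine (Finset.sum_le_sum fun s _ => h s).trans ?_
  rw [Finset.sum_add_distrib, Fintype.sum_prod_type (f := fun s : Fin m × Bool => ite _ _ _)]
  simp only [Fintype.sum_bool, ← two_mul, ← Finset.mul_sum, Finset.sum_ite_mem, Finset.univ_inter,
    Finset.sum_const, Finset.card_univ, Fintype.card_prod, Fintype.card_fin, Fintype.card_bool,
    nsmul_eq_mul]
  push_cast
  linarith

open LabeledGraph

theorem sum_weight_mul_le (hm : 64 < m) (z : FreeGroup (Fin m)) :
    ∑ s : Fin m × Bool, (1 / 4 : ℝ) ^ freeProductLength (FreeGroup.mk [s] * z) ≤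
      1 / 3 * (2 * m) * (1 / 4 : ℝ) ^ freeProductLength z := by
  obtain ⟨i, hi⟩ := exists_freeProductLength_mk_singleton_mul_eq z
  set Λ := (1 / 4 : ℝ) ^ freeProductLength z with hΛ
  have hΛ0 : 0 < Λ := by positivity
  have hm' : (65 : ℝ) ≤ m := by exact_mod_cast hm
  have key := sum_letters_le
    (fun s : Fin m × Bool => (1 / 4 : ℝ) ^ freeProductLength (FreeGroup.mk [s] * z)) i.toFinset
    (Λ / 4) (4 * Λ) (by positivity) (fun s hs => ?_) (fun s => ?_)
  · -- At most one generator shortens `z`; that there are more than `48` of them is enough here.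
    have hc : (i.toFinset.card : ℝ) ≤ 1 := by
      cases i <;> simp
    nlinarith
  · rw [hi s (by simpa [eq_comm] using hs), pow_succ]
    exact (by rw [← hΛ]; linarith)
  · have h1 := freeProductLength_le_mk_singleton_mul s z
    have h2 : (1 / 4 : ℝ) ^ (freeProductLength (FreeGroup.mk [s] * z) + 1) ≤ Λ :=
      pow_le_pow_of_le_one (by norm_num) (by norm_num) h1
    rw [pow_succ] at h2
    linarith

open Classical in
theorem sum_weight_conj_le (hm : 64 < m) (z : FreeGroup (Fin m)) :
    ∑ s : Fin m × Bool, (if FreeGroup.mk [s] * z * (FreeGroup.mk [s])⁻¹ = 1 then (0 : ℝ) else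
        (1 / 4 : ℝ) ^ freeProductLength (FreeGroup.mk [s] * z * (FreeGroup.mk [s])⁻¹)) ≤
      3 / 5 * (2 * m) * if z = 1 then 0 else (1 / 4 : ℝ) ^ freeProductLength z := by
  by_cases hz : z = 1
  · simp only [hz, mul_one, mul_inv_cancel, if_true, Finset.sum_const_zero, mul_zero, le_refl]
  obtain ⟨i, k, hik⟩ := exists_freeProductLength_conj_eq hz
  simp only [conj_eq_one_iff, hz, if_false]
  set Λ := (1 / 4 : ℝ) ^ freeProductLength z with hΛ
  have hΛ0 : 0 < Λ := by positivity
  have hm' : (65 : ℝ) ≤ m := by exact_mod_cast hm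
  have key := sum_letters_le (fun s : Fin m × Bool =>
      (1 / 4 : ℝ) ^ freeProductLength (FreeGroup.mk [s] * z * (FreeGroup.mk [s])⁻¹)) {i, k}
    (Λ / 16) (16 * Λ) (by positivity) (fun s hs => ?_) (fun s => ?_)
  · -- At most two generators are exceptional; here more than `59` generators are needed.
    have hc : ((({i, k} : Finset (Fin m)).card : ℕ) : ℝ) ≤ 2 := by
      exact_mod_cast Finset.card_le_two
    nlinarith
  · simp only [Finset.mem_insert, Finset.mem_singleton, not_or] at hs
    simp only [hik s hs.1 hs.2, pow_add]
    exact (by rw [← hΛ]; linarith)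
  · have h1 := freeProductLength_le_conj s z
    have h2 : (1 / 4 : ℝ) ^ (freeProductLength
        (FreeGroup.mk [s] * z * (FreeGroup.mk [s])⁻¹) + 2) ≤ Λ :=
      pow_le_pow_of_le_one (by norm_num) (by norm_num) h1
    rw [pow_add] at h2
    linarith

theorem sum_weight_signedProd_mul_le (hm : 64 < m) (l : List (E × Bool))
    (hl : (l.map Prod.fst).Nodup) (h : (E → Fin m × Bool) → FreeGroup (Fin m))
    (hh : ∀ e ∈ l.map Prod.fst, ∀ ω s, h (Function.update ω e s) = h ω) :
    ∑ ω, (1 / 4 : ℝ) ^ freeProductLength (signedProd (freeLabel ω) l * h ω) ≤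
      (1 / 3) ^ l.length * (Fintype.card (E → Fin m × Bool) : ℝ) := by
  have : NeZero m := ⟨by omega⟩
  have key := sum_weight_signedProd_le (MulAction.toPermHom (FreeGroup (Fin m)) (FreeGroup (Fin m)))
    (fun z => (1 / 4 : ℝ) ^ freeProductLength z) (1 / 3) (by norm_num) (sum_weight_mul_le hm) l hl
    h hh
  refine key.trans ?_
  gcongr
  refine (Finset.sum_le_sum fun ω _ => pow_le_one₀ (n := freeProductLength (h ω))
    (by norm_num : (0 : ℝ) ≤ 1 / 4) (by norm_num)).trans ?_
  simp

/-- A product of `n` independent random letters is the inverse of an element that is independent of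
them with probability at most `3⁻ⁿ`. -/
theorem uniformProb_signedProd_mul_eq_one_le (hm : 64 < m) (l : List (E × Bool))
    (hl : (l.map Prod.fst).Nodup) (h : (E → Fin m × Bool) → FreeGroup (Fin m))
    (hh : ∀ e ∈ l.map Prod.fst, ∀ ω s, h (Function.update ω e s) = h ω) :
    uniformProb (E → Fin m × Bool) {ω | signedProd (freeLabel ω) l * h ω = 1} ≤
      (1 / 3) ^ l.length := by
  refine uniformProb_le_of_sum_le _ _ _ (fun ω hω => ?_) (fun ω => ?_) (by positivity)
    (sum_weight_signedProd_mul_le hm l hl h hh)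
  · rw [Set.mem_ofPred_eq] at hω
    rw [hω, freeProductLength_one, pow_zero]
  · positivity

/-- A product of `n` independent random letters has syllable length less than `n / 2` with
probability at most `(2 / 3)ⁿ`. -/
theorem uniformProb_two_mul_freeProductLength_lt_le (hm : 64 < m) (l : List (E × Bool))
    (hl : (l.map Prod.fst).Nodup) :
    uniformProb (E → Fin m × Bool)
      {ω | 2 * freeProductLength (signedProd (freeLabel ω) l) < l.length} ≤
      (2 / 3) ^ l.length := by
  have key := sum_weight_signedProd_mul_le hm l hl (fun _ => 1) (fun _ _ _ _ => rfl)
  refine uniformProb_le_of_sum_le _ (fun ω => 2 ^ l.length *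
    (1 / 4 : ℝ) ^ freeProductLength (signedProd (freeLabel ω) l * 1)) _ (fun ω hω => ?_)
    (fun ω => by positivity) (by positivity) ?_
  · rw [Set.mem_ofPred_eq] at hω
    have h1 : (1 / 2 : ℝ) ^ l.length ≤
        (1 / 2 : ℝ) ^ (2 * freeProductLength (signedProd (freeLabel ω) l)) :=
      pow_le_pow_of_le_one (by norm_num) (by norm_num) hω.le
    rw [pow_mul] at h1
    norm_num at h1 ⊢
    calc (1 : ℝ) = 2 ^ l.length * (1 / 2) ^ l.length := by rw [← mul_pow]; norm_num
      _ ≤ _ := by gcongr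
  · rw [← Finset.mul_sum]
    calc _ ≤ (2 : ℝ) ^ l.length * ((1 / 3) ^ l.length * _) := by gcongr
      _ = _ := by rw [← mul_assoc, ← mul_pow]; norm_num

/-- A non-trivial element that is conjugated by a product of `n` independent random letters is
long with high probability. -/
theorem uniformProb_freeProductLength_conj_le_le (hm : 64 < m) (l : List (E × Bool))
    (hl : (l.map Prod.fst).Nodup) (h : (E → Fin m × Bool) → FreeGroup (Fin m))
    (hh : ∀ e ∈ l.map Prod.fst, ∀ ω s, h (Function.update ω e s) = h ω) (k : ℕ) :
    uniformProb (E → Fin m × Bool) {ω | h ω ≠ 1 ∧ freeProductLength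
      (signedProd (freeLabel ω) l * h ω * (signedProd (freeLabel ω) l)⁻¹) ≤ k} ≤
      4 ^ k * (3 / 5) ^ l.length := by
  classical
  have : NeZero m := ⟨by omega⟩
  have key := sum_weight_signedProd_le
    ((MulAut.toPerm (FreeGroup (Fin m))).comp MulAut.conj)
    (fun z => if z = 1 then (0 : ℝ) else (1 / 4 : ℝ) ^ freeProductLength z) (3 / 5) (by norm_num)
    (sum_weight_conj_le hm) l hl h hh
  refine uniformProb_le_of_sum_le _ (fun ω => 4 ^ k *
    (fun z => if z = 1 then (0 : ℝ) else (1 / 4 : ℝ) ^ freeProductLength z)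
      (((MulAut.toPerm (FreeGroup (Fin m))).comp MulAut.conj) (signedProd (freeLabel ω) l) (h ω)))
    _ (fun ω hω => ?_) (fun ω => by positivity) (by positivity) ?_
  · rw [Set.mem_ofPred_eq] at hω
    change 1 ≤ (4 : ℝ) ^ k * if _ * h ω * _⁻¹ = 1 then (0 : ℝ) else _
    rw [if_neg (by simpa [conj_eq_one_iff] using hω.1)]
    have h1 : (1 / 4 : ℝ) ^ k ≤ (1 / 4 : ℝ) ^ freeProductLength
        (signedProd (freeLabel ω) l * h ω * (signedProd (freeLabel ω) l)⁻¹) :=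
      pow_le_pow_of_le_one (by norm_num) (by norm_num) hω.2
    calc (1 : ℝ) = 4 ^ k * (1 / 4) ^ k := by rw [← mul_pow]; norm_num
      _ ≤ _ := mul_le_mul_of_nonneg_left h1 (by positivity)
  · rw [← Finset.mul_sum, mul_assoc]
    refine mul_le_mul_of_nonneg_left (key.trans ?_) (by positivity)
    gcongr
    refine (Finset.sum_le_sum fun ω _ => (?_ : _ ≤ (1 : ℝ))).trans ?_
    · split_ifs
      · norm_num
      · exact pow_le_one₀ (by norm_num) (by norm_num)
    · simp

end moments

/-! ### Edge labellings of graphs without short cycles -/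

namespace SimpleGraph

variable {W : Type*} {H : SimpleGraph W}

theorem Walk.exists_eq_append_of_exists_mem {u v : W} (p : H.Walk u v) (S : Set W)
    (h : ∃ w ∈ p.support, w ∈ S) :
    ∃ x ∈ S, ∃ (a : H.Walk u x) (r : H.Walk x v), p = a.append r ∧
      ∀ w ∈ a.support, w ∈ S → w = x := by
  induction p with
  | nil =>
    obtain ⟨w, hw, hwS⟩ := h
    simp only [Walk.support_nil, List.mem_singleton] at hw
    subst hw
    exact ⟨w, hwS, .nil, .nil, rfl, by simp⟩
  | @cons u u' v hadj p ih =>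
    by_cases hu : u ∈ S
    · exact ⟨u, hu, .nil, .cons hadj p, rfl, by simp⟩
    · obtain ⟨x, hx, a, r, hp, ha⟩ := ih (by
        obtain ⟨w, hw, hwS⟩ := h
        simp only [Walk.support_cons, List.mem_cons] at hw
        rcases hw with rfl | hw
        · exact absurd hwS hu
        · exact ⟨w, hw, hwS⟩)
      refine ⟨x, hx, .cons hadj a, r, by rw [hp, Walk.cons_append], ?_⟩
      intro w hw hwS
      simp only [Walk.support_cons, List.mem_cons] at hw
      rcases hw with rfl | hw
      · exact absurd hwS hu
      · exact ha w hw hwS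

theorem Walk.disjoint_edges_of_support_inter {u v u' v' x : W} (a : H.Walk u v) (q : H.Walk u' v')
    (h : ∀ w ∈ a.support, w ∈ q.support → w = x) : a.edges.Disjoint q.edges := by
  intro e ha hq
  induction e using Sym2.ind with
  | _ w w' =>
    have h1 := h w (a.fst_mem_support_of_mem_edges ha) (q.fst_mem_support_of_mem_edges hq)
    have h2 := h w' (a.snd_mem_support_of_mem_edges ha) (q.snd_mem_support_of_mem_edges hq)
    exact (a.adj_of_mem_edges ha).ne (h1.trans h2.symm)

/-- Where paths of total length less than `M` are determined by their endpoints, two such paths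
that meet have exactly one common segment `s`, which they traverse in the same direction or in
opposite directions. -/
theorem Walk.IsPath.exists_common_segment {M : ℕ}
    (hU : ∀ {x y : W} (p q : H.Walk x y), p.IsPath → q.IsPath → p.length + q.length < M → p = q)
    {u v u' v' : W} {p : H.Walk u v} {q : H.Walk u' v'} (hp : p.IsPath) (hq : q.IsPath)
    (hlen : p.length + q.length < M) (hmeet : ∃ w ∈ p.support, w ∈ q.support) :
    ∃ (x y : W) (a : H.Walk u x) (s : H.Walk x y) (b : H.Walk y v),
      p = a.append (s.append b) ∧
      ((∃ (c : H.Walk u' x) (d : H.Walk y v'), q = c.append (s.append d) ∧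
        (a.edges ++ s.edges ++ b.edges ++ c.edges ++ d.edges).Nodup) ∨
       (∃ (c : H.Walk u' y) (d : H.Walk x v'), q = c.append (s.reverse.append d) ∧
        (a.edges ++ s.edges ++ b.edges ++ c.edges ++ d.edges).Nodup)) := by
  classical
  obtain ⟨x, hx, a, r, rfl, ha⟩ := p.exists_eq_append_of_exists_mem {w | w ∈ q.support} hmeet
  obtain ⟨y, hy, b', s', hr, hb⟩ := r.reverse.exists_eq_append_of_exists_mem {w | w ∈ q.support}
    ⟨x, by simp, hx⟩
  obtain rfl : r = s'.reverse.append b'.reverse := by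
    rw [← Walk.reverse_append, ← hr, Walk.reverse_reverse]
  have hae : a.edges.Disjoint q.edges := a.disjoint_edges_of_support_inter q ha
  have hbe : b'.edges.Disjoint q.edges := b'.disjoint_edges_of_support_inter q hb
  have hs : s'.reverse.IsPath := (hp.of_append_right).of_append_left
  have hpe := hp.edges_nodup
  have hqe := hq.edges_nodup
  refine ⟨x, y, a, s'.reverse, b'.reverse, rfl, ?_⟩
  have hy' : y ∈ ((q.takeUntil x hx).append (q.dropUntil x hx)).support := by
    rw [Walk.take_spec]; exact hy
  simp only [Walk.length_append, Walk.length_reverse] at hlen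
  rw [Walk.mem_support_append_iff] at hy'
  rcases hy' with hy' | hy'
  · right
    have hq1 : (q.takeUntil x hx).append (q.dropUntil x hx) = q := q.take_spec hx
    have hq2 := (q.takeUntil x hx).take_spec hy'
    set c := (q.takeUntil x hx).takeUntil y hy'
    set t := (q.takeUntil x hx).dropUntil y hy'
    set d := q.dropUntil x hx
    rw [← hq2] at hq1
    have ht : t = s'.reverse.reverse := by
      refine hU _ _ ?_ hs.reverse ?_
      · rw [← hq1] at hq
        exact hq.of_append_left.of_append_right
      · have := congrArg Walk.length hq1
        simp only [Walk.length_append] at this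
        simp only [Walk.length_reverse]
        omega
    refine ⟨c, d, ?_, ?_⟩
    · rw [← hq1, ht, Walk.append_assoc]
    · rw [← hq1, ht] at hqe hae hbe
      simp only [Walk.edges_append, Walk.edges_reverse, List.nodup_append,
        List.mem_append, List.mem_reverse, List.nodup_reverse, List.Disjoint, ne_eq] at *
      grind
  · left
    have hq1 : (q.takeUntil x hx).append (q.dropUntil x hx) = q := q.take_spec hx
    have hq2 := (q.dropUntil x hx).take_spec hy'
    set c := q.takeUntil x hx
    set t := (q.dropUntil x hx).takeUntil y hy'
    set d := (q.dropUntil x hx).dropUntil y hy'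
    rw [← hq2] at hq1
    have ht : t = s'.reverse := by
      refine hU _ _ ?_ hs ?_
      · rw [← hq1] at hq
        exact hq.of_append_right.of_append_left
      · have := congrArg Walk.length hq1
        simp only [Walk.length_append] at this
        simp only [Walk.length_reverse]
        omega
    refine ⟨c, d, ?_, ?_⟩
    · rw [← hq1, ht]
    · rw [← hq1, ht] at hqe hae hbe
      simp only [Walk.edges_append, Walk.edges_reverse, List.nodup_append,
        List.mem_append, List.mem_reverse, List.nodup_reverse, List.Disjoint, ne_eq] at *
      grind

/-- Names in `E` for the edges of a graph, with an orientation of each edge: the edge from `u` to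
`v` has the name `(signed u v).1`, and the sign `(signed u v).2` tells whether its orientation is
the one from `u` to `v`.  The value of `signed` at non-adjacent vertices is irrelevant. -/
structure EdgeNaming (H : SimpleGraph W) (E : Type*) where
  /-- The name and the sign of an oriented edge. -/
  signed : W → W → E × Bool
  signed_symm : ∀ {u v}, H.Adj u v → signed v u = ((signed u v).1, !(signed u v).2)
  signed_inj : ∀ {u v u' v'}, H.Adj u v → H.Adj u' v' → (signed u v).1 = (signed u' v').1 →
    s(u, v) = s(u', v')

namespace EdgeNaming

variable {E : Type*} (N : H.EdgeNaming E)

/-- The signed edges that a walk traverses. -/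
def trace {u v : W} (p : H.Walk u v) : List (E × Bool) :=
  p.darts.map fun d => N.signed d.fst d.snd

/-- The product of the labels along a walk. -/
def label {G : Type*} [Group G] (f : E → G) {u v : W} (p : H.Walk u v) : G :=
  signedProd f (N.trace p)

@[simp]
theorem length_trace {u v : W} (p : H.Walk u v) : (N.trace p).length = p.length := by
  simp [trace]

theorem trace_append {u v w : W} (p : H.Walk u v) (q : H.Walk v w) :
    N.trace (p.append q) = N.trace p ++ N.trace q := by
  simp [trace]

theorem mem_map_fst_trace {u v : W} {p : H.Walk u v} {e : E} (he : e ∈ (N.trace p).map Prod.fst) :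
    ∃ x y, s(x, y) ∈ p.edges ∧ H.Adj x y ∧ (N.signed x y).1 = e := by
  simp only [trace, List.map_map, List.mem_map, Function.comp_apply] at he
  obtain ⟨d, hd, rfl⟩ := he
  exact ⟨d.fst, d.snd, List.mem_map_of_mem (f := Dart.edge) hd, d.adj, rfl⟩

theorem disjoint_map_fst_trace {u v u' v' : W} {p : H.Walk u v} {q : H.Walk u' v'}
    (h : p.edges.Disjoint q.edges) :
    ((N.trace p).map Prod.fst).Disjoint ((N.trace q).map Prod.fst) := by
  intro e hp hq
  obtain ⟨x, y, hxy, hadj, rfl⟩ := N.mem_map_fst_trace hp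
  obtain ⟨x', y', hxy', hadj', h'⟩ := N.mem_map_fst_trace hq
  rw [N.signed_inj hadj' hadj h'] at hxy'
  exact h hxy hxy'

theorem nodup_map_fst_trace {u v : W} {p : H.Walk u v} (h : p.edges.Nodup) :
    ((N.trace p).map Prod.fst).Nodup := by
  rw [trace, List.map_map, List.nodup_map_iff_inj_on]
  · intro d hd d' hd' heq
    have he : d.edge = d'.edge := N.signed_inj d.adj d'.adj heq
    exact List.inj_on_of_nodup_map (f := Dart.edge) h hd hd' he
  · exact List.Nodup.of_map _ h

section label

variable {G : Type*} [Group G] (f : E → G)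

@[simp]
theorem label_nil {u : W} : N.label f (Walk.nil : H.Walk u u) = 1 := rfl

theorem label_append {u v w : W} (p : H.Walk u v) (q : H.Walk v w) :
    N.label f (p.append q) = N.label f p * N.label f q := by
  simp [label, trace_append, signedProd_append]

theorem label_cons {u v w : W} (h : H.Adj u v) (p : H.Walk v w) :
    N.label f (Walk.cons h p) = (if (N.signed u v).2 then f (N.signed u v).1
      else (f (N.signed u v).1)⁻¹) * N.label f p := by
  simp [label, trace, signedProd_cons]

theorem label_reverse {u v : W} (p : H.Walk u v) : N.label f p.reverse = (N.label f p)⁻¹ := by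
  induction p with
  | nil => simp
  | cons h p ih =>
    rw [Walk.reverse_cons, label_append, ih, label_cons, label_cons, label_nil, mul_one,
      mul_inv_rev, N.signed_symm h]
    cases (N.signed _ _).2 <;> simp

end label

theorem label_update {m : ℕ} [DecidableEq E] (ω : E → Fin m × Bool) {u v : W} (p : H.Walk u v)
    {l : List E} (h : l.Disjoint ((N.trace p).map Prod.fst)) {e : E} (he : e ∈ l)
    (s : Fin m × Bool) :
    N.label (freeLabel (Function.update ω e s)) p = N.label (freeLabel ω) p := by
  refine signedProd_congr fun e' he' => ?_
  have : e' ≠ e := fun h' => h he (h' ▸ he')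
  simp [freeLabel, this]

/-- Every labelling of the edges by elements of a group is trivial on the closed walks of length
less than `M`: these walks are null-homotopic. -/
def TrivialBelow (M : ℕ) : Prop :=
  ∀ (G : Type) [Group G] (f : E → G) (u : W) (p : H.Walk u u), p.length < M → N.label f p = 1

variable {N} {M : ℕ} (hN : N.TrivialBelow M)

include hN

theorem TrivialBelow.label_eq {G : Type} [Group G] (f : E → G) {u v : W} (p q : H.Walk u v)
    (h : p.length + q.length < M) : N.label f p = N.label f q := by
  have := hN G f u (p.append q.reverse) (by simpa using h)
  rwa [label_append, label_reverse, mul_inv_eq_one] at this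

theorem TrivialBelow.le_length_of_isCycle {u : W} (p : H.Walk u u) (hp : p.IsCycle) :
    M ≤ p.length := by
  classical
  by_contra hM
  rw [not_le] at hM
  cases p with
  | nil => exact hp.ne_nil rfl
  | @cons _ v _ h p =>
    -- Label the first edge of the cycle by a generator of `ℤ`, and all the others trivially.
    set f : E → Multiplicative ℤ :=
      fun e => if e = (N.signed u v).1 then Multiplicative.ofAdd 1 else 1 with hf
    have h1 := hN _ f u _ hM
    have hnd := N.nodup_map_fst_trace hp.edges_nodup
    have hrest : N.label f p = 1 := by
      have : N.label f p = signedProd (fun _ => 1) (N.trace p) := by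
        refine signedProd_congr fun e he => if_neg ?_
        rintro rfl
        simp only [trace, Walk.darts_cons, List.map_cons, List.nodup_cons] at hnd
        exact hnd.1 he
      rw [this]
      simp [signedProd]
    rw [label_cons, hrest, mul_one] at h1
    revert h1
    simp only [hf, if_true]
    cases (N.signed u v).2 <;> decide

theorem TrivialBelow.path_unique {u v : W} (p q : H.Walk u v) (hp : p.IsPath) (hq : q.IsPath)
    (h : p.length + q.length < M) : p = q := by
  by_contra hne
  obtain ⟨w, -, -, c, hc, hcl⟩ := hp.exists_isCycle_length_le_add_of_ne hq hne
  have := hN.le_length_of_isCycle c hc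
  omega

end EdgeNaming

end SimpleGraph

/-! ### Probabilities of exceptional labels on short paths -/

namespace SimpleGraph.EdgeNaming

open LabeledGraph

/-- The square root of an element of the free group, if there is one. -/
noncomputable def sqrtOrOne {L : Type*} (g : FreeGroup L) : FreeGroup L :=
  open Classical in if h : ∃ r, r ^ 2 = g then h.choose else 1

theorem sqrtOrOne_sq {L : Type*} (g : FreeGroup L) : sqrtOrOne (g ^ 2) = g := by
  have h : ∃ r, r ^ 2 = g ^ 2 := ⟨g, rfl⟩
  rw [sqrtOrOne, dif_pos h]
  exact pow_left_injective two_ne_zero h.choose_spec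

theorem norm_label_le {m : ℕ} {W : Type*} {H : SimpleGraph W} {E : Type*} (N : H.EdgeNaming E)
    (ω : E → Fin m × Bool) {u v : W} (p : H.Walk u v) :
    (N.label (freeLabel ω) p).norm ≤ p.length := by
  induction p with
  | nil => simp
  | @cons u v w h p ih =>
    rw [label_cons, Walk.length_cons]
    refine (FreeGroup.norm_mul_le _ _).trans ?_
    have : ∀ e, (freeLabel ω e).norm ≤ 1 := fun e => FreeGroup.norm_mk_le
    split_ifs
    · linarith [this (N.signed u v).1]
    · rw [FreeGroup.norm_inv_eq]
      linarith [this (N.signed u v).1]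

variable {W : Type*} {H : SimpleGraph W} {E : Type*} [Fintype E] [DecidableEq E]
  (N : H.EdgeNaming E) {m : ℕ}

/-- A path `s` that is labelled independently of some others: its label has a prescribed value,
depending on the labels of the others only, with small probability. -/
theorem uniformProb_label_mul_eq_one_le (hm : 64 < m) {T : ℕ} {u v : W} (s : H.Walk u v)
    (hs : s.edges.Nodup) (hT : T ≤ s.length) (h : (E → Fin m × Bool) → FreeGroup (Fin m))
    (hh : ∀ e ∈ (N.trace s).map Prod.fst, ∀ ω x, h (Function.update ω e x) = h ω)
    (X : Set (E → Fin m × Bool)) (hX : ∀ ω ∈ X, N.label (freeLabel ω) s * h ω = 1) :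
    uniformProb (E → Fin m × Bool) X ≤ (1 / 3) ^ T := by
  have h1 := uniformProb_signedProd_mul_eq_one_le hm (N.trace s) (N.nodup_map_fst_trace hs) h hh
  rw [length_trace] at h1
  have : NeZero m := ⟨by omega⟩
  refine (uniformProb_mono hX).trans (h1.trans ?_)
  exact pow_le_pow_of_le_one (by norm_num) (by norm_num) hT

theorem uniformProb_label_short_le (hm : 64 < m) {T : ℕ} {u v : W} (p : H.Walk u v)
    (hp : p.edges.Nodup) (hT : T ≤ p.length) :
    uniformProb (E → Fin m × Bool)
      {ω | 2 * freeProductLength (N.label (freeLabel ω) p) < p.length} ≤ (2 / 3) ^ T := by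
  have h1 := uniformProb_two_mul_freeProductLength_lt_le hm (N.trace p) (N.nodup_map_fst_trace hp)
  rw [length_trace] at h1
  exact h1.trans (pow_le_pow_of_le_one (by norm_num) (by norm_num) hT)

variable {N} {M : ℕ}

/-- Two paths of lengths at least `10 T` carry the same label although their starting points are
not identified by the folding with probability at most `(1 / 3) ^ T`.  If the paths overlap in a
long segment `s` in the same direction, then the label of `s` conjugates a short element to a short
element; if they overlap in opposite directions, the label of `s` is determined by those of the
other segments as roots are unique in the free group. -/
theorem TrivialBelow.uniformProb_label_eq_le (hN : N.TrivialBelow M) (hm : 64 < m) {T : ℕ}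
    {u v u' v' : W} (p : H.Walk u v) (q : H.Walk u' v') (hp : p.IsPath) (hq : q.IsPath)
    (hpT : 10 * T ≤ p.length) (hlen : p.length + q.length < M) :
    uniformProb (E → Fin m × Bool) {ω | N.label (freeLabel ω) p = N.label (freeLabel ω) q ∧
      ∀ r : H.Walk u u', N.label (freeLabel ω) r ≠ 1} ≤ (1 / 3) ^ T := by
  by_cases hmeet : ∃ w ∈ p.support, w ∈ q.support
  swap
  · refine N.uniformProb_label_mul_eq_one_le hm p hp.edges_nodup (by omega)
      (fun ω => (N.label (freeLabel ω) q)⁻¹) (fun e he ω x => ?_) _ (fun ω hω => ?_)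
    · rw [N.label_update ω q (N.disjoint_map_fst_trace (p.disjoint_edges_of_support_inter
        (x := u) q fun w hw hw' => (hmeet ⟨w, hw, hw'⟩).elim)) he]
    · rw [hω.1, mul_inv_cancel]
  obtain ⟨x, y, a, s, b, rfl, h⟩ :=
    hp.exists_common_segment (fun p q hp hq h => hN.path_unique p q hp hq h) hq hlen hmeet
  simp only [Walk.length_append] at hpT
  rcases h with ⟨c, d, rfl, hnd⟩ | ⟨c, d, rfl, hnd⟩
  all_goals
    simp only [List.nodup_append', List.disjoint_append_left] at hnd
    obtain ⟨⟨⟨⟨ha, hs, has⟩, hb, hab, hsb⟩, hc, ⟨hac, hsc⟩, hbc⟩, hd, ⟨⟨had, hsd⟩, hbd⟩, hcd⟩ := hnd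
    have upd : ∀ {x₁ y₁ x₂ y₂ : W} {s₁ : H.Walk x₁ y₁} {s₂ : H.Walk x₂ y₂}
        (_ : s₁.edges.Disjoint s₂.edges) {e : E} (_ : e ∈ (N.trace s₁).map Prod.fst)
        (ω : E → Fin m × Bool) (t : Fin m × Bool),
        N.label (freeLabel (Function.update ω e t)) s₂ = N.label (freeLabel ω) s₂ :=
      fun h _ he ω t => N.label_update ω _ (N.disjoint_map_fst_trace h) he t
    simp only [label_append, label_reverse]
  · by_cases haT : T ≤ a.length
    · refine N.uniformProb_label_mul_eq_one_le hm a ha haT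
        (fun ω => N.label (freeLabel ω) s * N.label (freeLabel ω) b * (N.label (freeLabel ω) c *
          (N.label (freeLabel ω) s * N.label (freeLabel ω) d))⁻¹) (fun e he ω t => ?_) _
        (fun ω hω => ?_)
      · simp only [upd has he, upd hab he, upd hac he, upd had he]
      · rw [← hω.1]; group
    by_cases hbT : T ≤ b.length
    · refine N.uniformProb_label_mul_eq_one_le hm b hb hbT
        (fun ω => (N.label (freeLabel ω) c * (N.label (freeLabel ω) s *
          N.label (freeLabel ω) d))⁻¹ * (N.label (freeLabel ω) a * N.label (freeLabel ω) s))
          (fun e he ω t => ?_) _ (fun ω hω => ?_)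
      · simp only [upd hab.symm he, upd hsb.symm he, upd hbc he, upd hbd he]
      · rw [← hω.1]; group
    by_cases hcT : T ≤ c.length
    · refine N.uniformProb_label_mul_eq_one_le hm c hc hcT
        (fun ω => N.label (freeLabel ω) s * N.label (freeLabel ω) d * (N.label (freeLabel ω) a *
          (N.label (freeLabel ω) s * N.label (freeLabel ω) b))⁻¹) (fun e he ω t => ?_) _
        (fun ω hω => ?_)
      · simp only [upd hac.symm he, upd hsc.symm he, upd hbc.symm he, upd hcd he]
      · rw [hω.1]; group
    by_cases hdT : T ≤ d.length
    · refine N.uniformProb_label_mul_eq_one_le hm d hd hdT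
        (fun ω => (N.label (freeLabel ω) a * (N.label (freeLabel ω) s *
          N.label (freeLabel ω) b))⁻¹ * (N.label (freeLabel ω) c * N.label (freeLabel ω) s))
          (fun e he ω t => ?_) _ (fun ω hω => ?_)
      · simp only [upd had.symm he, upd hsd.symm he, upd hbd.symm he, upd hcd.symm he]
      · rw [hω.1]; group
    have key := uniformProb_freeProductLength_conj_le_le hm (N.trace s) (N.nodup_map_fst_trace hs)
      (fun ω => N.label (freeLabel ω) b * (N.label (freeLabel ω) d)⁻¹)
      (fun e he ω t => by simp only [upd hsb he, upd hsd he]) (2 * T)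
    have : NeZero m := ⟨by omega⟩
    refine (uniformProb_mono fun ω hω => ?_).trans (key.trans ?_)
    · have hx : N.label (freeLabel ω) s * (N.label (freeLabel ω) b *
          (N.label (freeLabel ω) d)⁻¹) * (N.label (freeLabel ω) s)⁻¹ =
          (N.label (freeLabel ω) a)⁻¹ * N.label (freeLabel ω) c := by
        have h1 := hω.1
        rw [← mul_assoc, ← mul_assoc] at h1
        rw [eq_inv_mul_iff_mul_eq]
        calc _ = (N.label (freeLabel ω) a * N.label (freeLabel ω) s * N.label (freeLabel ω) b) *
              (N.label (freeLabel ω) d)⁻¹ * (N.label (freeLabel ω) s)⁻¹ := by group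
          _ = _ := by rw [h1]; group
      refine ⟨fun h1 => ?_, ?_⟩
      · rw [h1, mul_one, mul_inv_cancel] at hx
        refine hω.2 (a.append c.reverse) ?_
        rw [label_append, label_reverse, mul_inv_eq_one]
        exact (inv_mul_eq_one.1 hx.symm)
      · change freeProductLength (N.label (freeLabel ω) s * _ * (N.label (freeLabel ω) s)⁻¹) ≤ _
        rw [hx]
        refine (freeProductLength_le_norm _).trans ((FreeGroup.norm_mul_le _ _).trans ?_)
        rw [FreeGroup.norm_inv_eq]
        have h1 := N.norm_label_le ω a
        have h2 := N.norm_label_le ω c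
        omega
    · rw [length_trace]
      -- The factor `10` in the hypothesis on the length of `p` is chosen for this estimate.
      calc (4 : ℝ) ^ (2 * T) * (3 / 5) ^ s.length ≤ 4 ^ (2 * T) * (3 / 5) ^ (8 * T) := by
            refine mul_le_mul_of_nonneg_left ?_ (by positivity)
            exact pow_le_pow_of_le_one (by norm_num) (by norm_num) (by omega)
        _ = (4 ^ 2 * (3 / 5) ^ 8) ^ T := by rw [mul_pow, ← pow_mul, ← pow_mul]
        _ ≤ (1 / 3) ^ T := pow_le_pow_left₀ (by norm_num) (by norm_num) T
  · by_cases haT : T ≤ a.length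
    · refine N.uniformProb_label_mul_eq_one_le hm a ha haT
        (fun ω => N.label (freeLabel ω) s * N.label (freeLabel ω) b * (N.label (freeLabel ω) c *
          ((N.label (freeLabel ω) s)⁻¹ * N.label (freeLabel ω) d))⁻¹) (fun e he ω t => ?_) _
        (fun ω hω => ?_)
      · simp only [upd has he, upd hab he, upd hac he, upd had he]
      · rw [← hω.1]; group
    by_cases hbT : T ≤ b.length
    · refine N.uniformProb_label_mul_eq_one_le hm b hb hbT
        (fun ω => (N.label (freeLabel ω) c * ((N.label (freeLabel ω) s)⁻¹ *
          N.label (freeLabel ω) d))⁻¹ * (N.label (freeLabel ω) a * N.label (freeLabel ω) s))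
          (fun e he ω t => ?_) _ (fun ω hω => ?_)
      · simp only [upd hab.symm he, upd hsb.symm he, upd hbc he, upd hbd he]
      · rw [← hω.1]; group
    -- With `y = b d⁻¹`, the equation `a s b = c s⁻¹ d` becomes `(s y)² = a⁻¹ c y`.
    refine N.uniformProb_label_mul_eq_one_le hm s hs (by omega)
      (fun ω => N.label (freeLabel ω) b * (N.label (freeLabel ω) d)⁻¹ *
        (sqrtOrOne ((N.label (freeLabel ω) a)⁻¹ * N.label (freeLabel ω) c *
          (N.label (freeLabel ω) b * (N.label (freeLabel ω) d)⁻¹)))⁻¹) (fun e he ω t => ?_) _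
      (fun ω hω => ?_)
    · simp only [upd has.symm he, upd hsb he, upd hsc he, upd hsd he]
    · have h1 := hω.1
      have h2 : (N.label (freeLabel ω) a)⁻¹ * N.label (freeLabel ω) c *
          (N.label (freeLabel ω) b * (N.label (freeLabel ω) d)⁻¹) =
          (N.label (freeLabel ω) s *
            (N.label (freeLabel ω) b * (N.label (freeLabel ω) d)⁻¹)) ^ 2 := by
        have h3 : N.label (freeLabel ω) c = N.label (freeLabel ω) a * (N.label (freeLabel ω) s *
            N.label (freeLabel ω) b) * (N.label (freeLabel ω) d)⁻¹ * N.label (freeLabel ω) s := by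
          rw [h1]; group
        rw [h3, pow_two]; group
      rw [h2, sqrtOrOne_sq]
      group

end SimpleGraph.EdgeNaming

/-! ### Folding a graph whose short paths have long labels -/

namespace LabeledGraph

variable {V L : Type*} {Γ : LabeledGraph V L}

theorem step_inv_iff {u v : V} {s : L × Bool} : Γ.Step v (s.1, !s.2) u ↔ Γ.Step u s v := by
  obtain ⟨a, b⟩ := s
  cases b <;> simp [Step]

theorem IsReduced.step_unique (h : Γ.IsReduced) {u v v' : V} {s : L × Bool} (h1 : Γ.Step u s v)
    (h2 : Γ.Step u s v') : v = v' := by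
  obtain ⟨a, b⟩ := s
  cases b
  · exact h.2 a v v' u (by simpa [Step] using h1) (by simpa [Step] using h2)
  · exact h.1 a u v v' (by simpa [Step] using h1) (by simpa [Step] using h2)

theorem step_fold {u v : V} {s : L × Bool} (h : Γ.Step u s v) :
    Γ.fold.Step (Quotient.mk Γ.foldSetoid u) s (Quotient.mk Γ.foldSetoid v) := by
  obtain ⟨a, b⟩ := s
  cases b
  · exact ⟨v, u, by simpa [Step] using h, rfl, rfl⟩
  · exact ⟨u, v, by simpa [Step] using h, rfl, rfl⟩

theorem exists_step_of_step_fold {x y : Quotient Γ.foldSetoid} {s : L × Bool}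
    (h : Γ.fold.Step x s y) : ∃ u v, Γ.Step u s v ∧ Quotient.mk Γ.foldSetoid u = x ∧
      Quotient.mk Γ.foldSetoid v = y := by
  obtain ⟨a, b⟩ := s
  cases b
  · obtain ⟨v, u, h, hv, hu⟩ := h
    exact ⟨u, v, h, hu, hv⟩
  · obtain ⟨u, v, h, hu, hv⟩ := h
    exact ⟨u, v, h, hu, hv⟩

/-- `Γ.Reads u w v`: the word `w` can be read on a path, possibly with backtracking, from `u` to
`v`. -/
def Reads (Γ : LabeledGraph V L) : V → List (L × Bool) → V → Prop
  | u, [], v => u = v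
  | u, s :: w, v => ∃ z, Γ.Step u s z ∧ Γ.Reads z w v

theorem reads_append {u v : V} {w w' : List (L × Bool)} :
    Γ.Reads u (w ++ w') v ↔ ∃ z, Γ.Reads u w z ∧ Γ.Reads z w' v := by
  induction w generalizing u with
  | nil => simp [Reads]
  | cons s w ih =>
    simp only [List.cons_append, Reads, ih]
    constructor
    · rintro ⟨z, h1, z', h2, h3⟩
      exact ⟨z', ⟨z, h1, h2⟩, h3⟩
    · rintro ⟨z', ⟨z, h1, h2⟩, h3⟩
      exact ⟨z, h1, z', h2, h3⟩

theorem Reads.fold {u v : V} {w : List (L × Bool)} (h : Γ.Reads u w v) :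
    Γ.fold.Reads (Quotient.mk Γ.foldSetoid u) w (Quotient.mk Γ.foldSetoid v) := by
  induction w generalizing u with
  | nil => exact congrArg _ h
  | cons s w ih =>
    obtain ⟨z, h1, h2⟩ := h
    exact ⟨_, step_fold h1, ih h2⟩

theorem IsReduced.reads_of_red (hΓ : Γ.IsReduced) {w w' : List (L × Bool)}
    (h : FreeGroup.Red w w') {u v : V} (hw : Γ.Reads u w v) : Γ.Reads u w' v := by
  induction h with
  | refl => exact hw
  | tail _ hstep ih =>
    cases hstep with
    | @not w₁ w₂ a b =>
      obtain ⟨z, h1, z₁, hz₁, z₂, hz₂, h2⟩ := reads_append.1 ih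
      have h3 : Γ.Step z₁ (a, !b) z := step_inv_iff.2 hz₁
      rw [← hΓ.step_unique h3 hz₂] at h2
      exact reads_append.2 ⟨z, h1, h2⟩

theorem foldRel_of_reads {u v : V} {w : List (L × Bool)} (h : Γ.Reads u w v)
    (hw : FreeGroup.mk w = 1) : Γ.FoldRel u v := by
  classical
  have hred : FreeGroup.Red w [] := by
    have h1 : FreeGroup.reduce w = [] := by
      rw [← FreeGroup.toWord_mk, hw, FreeGroup.toWord_one]
    have h2 : FreeGroup.Red w (FreeGroup.reduce w) := FreeGroup.reduce.red
    rwa [h1] at h2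
  exact Quotient.exact (s := Γ.foldSetoid) (Γ.fold_isReduced.reads_of_red hred h.fold)

theorem isWalk_append {u : V} {l l' : List ((L × Bool) × V)} :
    Γ.IsWalk u (l ++ l') ↔ Γ.IsWalk u l ∧ Γ.IsWalk (l.foldl (fun _ s => s.2) u) l' := by
  induction l generalizing u with
  | nil => simp [IsWalk]
  | cons s l ih =>
    obtain ⟨s, v⟩ := s
    change Γ.Step u s v ∧ Γ.IsWalk v (l ++ l') ↔ (Γ.Step u s v ∧ Γ.IsWalk v l) ∧ _
    rw [ih, and_assoc]
    rfl

theorem IsReduced.isWalk_unique (hΓ : Γ.IsReduced) {u : V} {l l' : List ((L × Bool) × V)}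
    (h : Γ.IsWalk u l) (h' : Γ.IsWalk u l') (hw : l.map Prod.fst = l'.map Prod.fst) : l = l' := by
  induction l generalizing u l' with
  | nil => exact (List.map_eq_nil_iff.1 hw.symm).symm
  | cons s l ih =>
    cases l' with
    | nil => simp at hw
    | cons s' l' =>
      obtain ⟨s, v⟩ := s
      obtain ⟨s', v'⟩ := s'
      simp only [List.map_cons, List.cons.injEq] at hw
      obtain ⟨rfl, hw⟩ := hw
      obtain rfl := hΓ.step_unique h.1 h'.1
      rw [ih h.2 h'.2 hw]

theorem IsReduced.isReduced_map_fst (hΓ : Γ.IsReduced) {u : V} {l : List ((L × Bool) × V)}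
    (h : Γ.IsWalk u l) (hb : NoBacktracking u l) : FreeGroup.IsReduced (l.map Prod.fst) := by
  induction l generalizing u with
  | nil => exact FreeGroup.IsReduced.nil
  | cons s l ih =>
    cases l with
    | nil => exact FreeGroup.IsReduced.singleton
    | cons t l =>
      obtain ⟨s, v⟩ := s
      obtain ⟨t, w⟩ := t
      have h2 := ih h.2 hb.2
      rw [List.map_cons, List.map_cons, FreeGroup.isReduced_cons_cons]
      refine ⟨fun h1 => ?_, h2⟩
      by_contra hne
      have ht : t = (s.1, !s.2) := by
        obtain ⟨a, b⟩ := s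
        obtain ⟨a', b'⟩ := t
        simp only at h1 hne
        subst h1
        cases b <;> cases b' <;> simp_all
      refine hb.1 ⟨ht, ?_⟩
      have h3 : Γ.Step v t w := h.2.1
      rw [ht] at h3
      exact hΓ.step_unique h3 (step_inv_iff.2 h.1)

theorem norm_mk_of_isReduced [DecidableEq L] {w : List (L × Bool)} (h : FreeGroup.IsReduced w) :
    (FreeGroup.mk w).norm = w.length := by
  rw [FreeGroup.norm, FreeGroup.toWord_mk, h.reduce_eq]

end LabeledGraph

namespace SimpleGraph.EdgeNaming

open LabeledGraph

variable {W E L : Type*} {H : SimpleGraph W}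

/-- The labelled graph `Γ` is the graph `H` with the edge labels `f`. -/
structure Represents (N : H.EdgeNaming E) (f : E → FreeGroup L) (Γ : LabeledGraph W L) : Prop where
  exists_adj : ∀ {u s v}, Γ.Step u s v →
    ∃ h : H.Adj u v, N.label f (Walk.cons h Walk.nil) = FreeGroup.mk [s]
  exists_step : ∀ {u v} (h : H.Adj u v),
    ∃ s, Γ.Step u s v ∧ N.label f (Walk.cons h Walk.nil) = FreeGroup.mk [s]

variable {N : H.EdgeNaming E} {f : E → FreeGroup L} {Γ : LabeledGraph W L}

theorem Represents.exists_reads (hΓ : N.Represents f Γ) {u v : W} (p : H.Walk u v) :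
    ∃ w, Γ.Reads u w v ∧ N.label f p = FreeGroup.mk w := by
  induction p with
  | nil => exact ⟨[], rfl, rfl⟩
  | cons h p ih =>
    obtain ⟨w, h1, h2⟩ := ih
    obtain ⟨s, h3, h4⟩ := hΓ.exists_step h
    refine ⟨s :: w, ⟨_, h3, h1⟩, ?_⟩
    have := N.label_append f (Walk.cons h Walk.nil) p
    rw [Walk.cons_append, Walk.nil_append] at this
    rw [this, h4, h2, FreeGroup.mul_mk, List.singleton_append]

theorem Represents.foldRel_of_label_eq_one (hΓ : N.Represents f Γ) {u v : W} (p : H.Walk u v)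
    (hp : N.label f p = 1) : Γ.FoldRel u v := by
  obtain ⟨w, h1, h2⟩ := hΓ.exists_reads p
  exact foldRel_of_reads h1 (h2.symm.trans hp)

section

variable {L : Type} [DecidableEq L] {f : E → FreeGroup L} {Γ : LabeledGraph W L} {M R T : ℕ}

/-- A walk of length at most `R` can be replaced by a path with the same label and endpoints, of
length at most `T` or bounded by the length of the label. -/
theorem exists_isPath_length_le (hN : N.TrivialBelow M) (hR : 2 * R < M)
    (hG : ∀ {u v : W} (p : H.Walk u v), p.IsPath → T < p.length → p.length ≤ R →
      p.length ≤ 2 * freeProductLength (N.label f p))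
    {u v : W} (p : H.Walk u v) (hp : p.length ≤ R) :
    ∃ q : H.Walk u v, q.IsPath ∧ N.label f q = N.label f p ∧
      (q.length ≤ T ∨ q.length ≤ 2 * freeProductLength (N.label f p)) := by
  classical
  have hl := p.length_bypass_le_length
  have hlab : N.label f p.bypass = N.label f p := hN.label_eq f _ _ (by omega)
  refine ⟨p.bypass, p.bypass_isPath, hlab, ?_⟩
  by_cases h : p.bypass.length ≤ T
  · exact Or.inl h
  · right
    rw [← hlab]
    exact hG _ p.bypass_isPath (by omega) (by omega)

/-- Vertices that are identified by folding are joined by a path of length at most `T` with trivial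
label.  Walks with trivial label that are longer than `T` do not occur below the length `R`, so
that none of the steps in the generation of the relation leads beyond `T`. -/
theorem Represents.exists_walk_of_foldRel (hΓ : N.Represents f Γ) (hN : N.TrivialBelow M)
    (hR : 2 * R < M) (hTR : 2 * T + 2 ≤ R)
    (hG : ∀ {u v : W} (p : H.Walk u v), p.IsPath → T < p.length → p.length ≤ R →
      p.length ≤ 2 * freeProductLength (N.label f p))
    {u v : W} (h : Γ.FoldRel u v) : ∃ p : H.Walk u v, p.length ≤ T ∧ N.label f p = 1 := by
  have short : ∀ {u v : W} (p : H.Walk u v), p.length ≤ R → N.label f p = 1 →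
      ∃ p : H.Walk u v, p.length ≤ T ∧ N.label f p = 1 := by
    intro u v p hp h1
    obtain ⟨q, -, hq, hqT⟩ := exists_isPath_length_le hN hR hG p hp
    rw [h1] at hq hqT
    refine ⟨q, ?_, hq⟩
    rw [freeProductLength_one] at hqT
    omega
  induction h with
  | refl u => exact ⟨.nil, by simp, by simp⟩
  | symm _ ih =>
    obtain ⟨p, hp, hp1⟩ := ih
    exact ⟨p.reverse, by simpa using hp, by rw [label_reverse, hp1, inv_one]⟩
  | trans _ _ ih ih' =>
    obtain ⟨p, hp, hp1⟩ := ih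
    obtain ⟨q, hq, hq1⟩ := ih'
    refine short (p.append q) ?_ (by rw [label_append, hp1, hq1, one_mul])
    rw [Walk.length_append]; omega
  | @forward a u v u' v' h h' _ ih =>
    obtain ⟨p, hp, hp1⟩ := ih
    obtain ⟨hadj, hl⟩ := hΓ.exists_adj (s := (a, true)) (u := u) (v := v) h
    obtain ⟨hadj', hl'⟩ := hΓ.exists_adj (s := (a, true)) (u := u') (v := v') h'
    refine short ((Walk.cons hadj .nil).reverse.append (p.append (Walk.cons hadj' .nil))) ?_ ?_
    · simp only [Walk.length_append, Walk.length_reverse, Walk.length_cons, Walk.length_nil]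
      omega
    · rw [label_append, label_reverse, label_append, hp1, hl, hl', one_mul, inv_mul_cancel]
  | @backward a u v u' v' h h' _ ih =>
    obtain ⟨p, hp, hp1⟩ := ih
    obtain ⟨hadj, hl⟩ := hΓ.exists_adj (s := (a, true)) (u := u) (v := v) h
    obtain ⟨hadj', hl'⟩ := hΓ.exists_adj (s := (a, true)) (u := u') (v := v') h'
    refine short ((Walk.cons hadj .nil).append (p.append (Walk.cons hadj' .nil).reverse)) ?_ ?_
    · simp only [Walk.length_append, Walk.length_reverse, Walk.length_cons, Walk.length_nil]
      omega
    · rw [label_append, label_append, label_reverse, hp1, hl, hl', one_mul, mul_inv_cancel]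

/-- A short path in the folded graph comes from a path with the same label in the graph. -/
theorem Represents.exists_isPath_of_isWalk_fold (hΓ : N.Represents f Γ) (hN : N.TrivialBelow M)
    (hR : 2 * R < M) (hTR : 2 * T + 2 ≤ R)
    (hG : ∀ {u v : W} (p : H.Walk u v), p.IsPath → T < p.length → p.length ≤ R →
      p.length ≤ 2 * freeProductLength (N.label f p))
    (x : Quotient Γ.foldSetoid) (l : List ((L × Bool) × Quotient Γ.foldSetoid))
    (hl : Γ.fold.IsWalk x l) (hlR : 2 * l.length + T + 1 ≤ R) :
    ∃ (u v : W) (p : H.Walk u v), Quotient.mk Γ.foldSetoid u = x ∧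
      Quotient.mk Γ.foldSetoid v = l.foldl (fun _ s => s.2) x ∧ p.IsPath ∧
      N.label f p = FreeGroup.mk (l.map Prod.fst) ∧ p.length ≤ max T (2 * l.length) := by
  induction l generalizing x with
  | nil =>
    obtain ⟨u, rfl⟩ := Quotient.exists_rep x
    exact ⟨u, u, .nil, rfl, rfl, by simp, rfl, by simp⟩
  | cons s l ih =>
    obtain ⟨s, y⟩ := s
    obtain ⟨hs, hl⟩ := hl
    rw [List.length_cons] at hlR
    obtain ⟨u, v, p, hu, hv, -, hp, hpl⟩ := ih y hl (by omega)
    obtain ⟨u₀, v₀, hstep, hu₀, hv₀⟩ := exists_step_of_step_fold hs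
    obtain ⟨hadj, hlab⟩ := hΓ.exists_adj hstep
    obtain ⟨r, hr, hr1⟩ := hΓ.exists_walk_of_foldRel hN hR hTR hG
      (Quotient.exact (s := Γ.foldSetoid) (hv₀.trans hu.symm))
    obtain ⟨q, hq, hqlab, hql⟩ := exists_isPath_length_le hN hR hG
      ((Walk.cons hadj .nil).append (r.append p)) (by
        simp only [Walk.length_append, Walk.length_cons, Walk.length_nil]
        omega)
    have hlabel : N.label f ((Walk.cons hadj .nil).append (r.append p)) =
        FreeGroup.mk (((s, y) :: l).map Prod.fst) := by
      rw [label_append, label_append, hlab, hr1, hp, one_mul, FreeGroup.mul_mk]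
      rfl
    refine ⟨u₀, v, q, hu₀, hv, hq, hqlab.trans hlabel, ?_⟩
    rw [hlabel] at hql
    have := freeProductLength_mk_le (((s, y) :: l).map Prod.fst)
    rw [List.length_map] at this
    omega

end

/-- The folded graph satisfies both small cancellation conditions if, on the scale between `T` and
`(2 * B + 2) * T`, paths have long labels, and paths with equal labels have starting points that the
folding identifies: then pieces are shorter than `10 * T`, and the labels of non-trivial cycles have
syllable length at least `B * T / 2`. -/
theorem Represents.gr_fold {M T m : ℕ} {ω : E → Fin m × Bool}
    {Γ : LabeledGraph W (Fin m)} (hΓ : N.Represents (freeLabel ω) Γ) (hN : N.TrivialBelow M)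
    {B : ℕ} (hB : 10 ≤ B) (hT : 1 ≤ T) (hM : 2 * ((2 * B + 2) * T) < M) {α : ℝ} (hα : 20 ≤ α * B)
    (hG : ∀ {u v : W} (p : H.Walk u v), p.IsPath → T < p.length → p.length ≤ (2 * B + 2) * T →
      p.length ≤ 2 * freeProductLength (N.label (freeLabel ω) p))
    (hG' : ∀ {u v u' v' : W} (p : H.Walk u v) (q : H.Walk u' v'), p.IsPath → q.IsPath →
      10 * T ≤ p.length → p.length ≤ 20 * T → q.length ≤ 20 * T →
      N.label (freeLabel ω) p = N.label (freeLabel ω) q →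
      ∃ r : H.Walk u u', N.label (freeLabel ω) r = 1) :
    Γ.fold.GrStar α ∧ Γ.fold.Gr α := by
  have hBT : 10 * T ≤ B * T := Nat.mul_le_mul_right T hB
  have hRT : (2 * B + 2) * T = 2 * (B * T) + 2 * T := by ring
  set R := (2 * B + 2) * T with hRdef
  have lift := fun x l => hΓ.exists_isPath_of_isWalk_fold hN hM (by omega) hG x l
  have hpiece : ∀ p : Γ.fold.ReducedPath, p.IsPiece → p.steps.length < 10 * T := by
    rintro p ⟨q, hqp, hw⟩
    by_contra hlen
    rw [not_lt] at hlen
    have hlen' : p.steps.length = q.steps.length := by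
      have := congrArg List.length hw
      simpa [ReducedPath.word] using this.symm
    have hstart : q.start ≠ p.start := by
      intro h
      refine hqp (ReducedPath.ext h (Γ.fold_isReduced.isWalk_unique q.isWalk ?_ hw))
      rw [h]
      exact p.isWalk
    have take : ∀ r : Γ.fold.ReducedPath, Γ.fold.IsWalk r.start (r.steps.take (10 * T)) := by
      intro r
      have h := r.isWalk
      rw [← List.take_append_drop (10 * T) r.steps] at h
      exact (isWalk_append.1 h).1
    have hp10 : (p.steps.take (10 * T)).length = 10 * T := by
      rw [List.length_take]; omega
    have hq10 : (q.steps.take (10 * T)).length = 10 * T := by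
      rw [List.length_take]; omega
    obtain ⟨u, v, P, hu, -, hP, hPlab, hPl⟩ := lift _ _ (take p) (by omega)
    obtain ⟨u', v', Q, hu', -, hQ, hQlab, hQl⟩ := lift _ _ (take q) (by omega)
    rw [hp10] at hPl
    rw [hq10] at hQl
    have hred : FreeGroup.IsReduced ((p.steps.take (10 * T)).map Prod.fst) := by
      rw [List.map_take]
      exact (Γ.fold_isReduced.isReduced_map_fst p.isWalk p.noBacktracking).infix
        (List.take_prefix _ _).isInfix
    have hPlong : 10 * T ≤ P.length := by
      have h1 := N.norm_label_le ω P
      rwa [hPlab, norm_mk_of_isReduced hred, List.length_map, hp10] at h1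
    have heq : N.label (freeLabel ω) P = N.label (freeLabel ω) Q := by
      rw [hPlab, hQlab, List.map_take, List.map_take]
      exact congrArg (fun w => FreeGroup.mk (List.take (10 * T) w)) hw.symm
    obtain ⟨r, hr⟩ := hG' P Q hP hQ hPlong (by omega) (by omega) heq
    refine hstart ?_
    rw [← hu, ← hu']
    exact (Quotient.sound (s := Γ.foldSetoid) (hΓ.foldRel_of_label_eq_one r hr)).symm
  have hcycle : ∀ c : Γ.fold.ReducedPath, c.IsNontrivialCycle →
      B * T ≤ 2 * freeProductLength c.label := by
    rintro c ⟨hne, hclosed⟩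
    have hred := Γ.fold_isReduced.isReduced_map_fst c.isWalk c.noBacktracking
    by_cases hlen : c.steps.length ≤ B * T
    · exfalso
      obtain ⟨u, v, p, hu, hv, -, hplab, hpl⟩ := lift _ _ c.isWalk (by omega)
      obtain ⟨r, hr, hr1⟩ := hΓ.exists_walk_of_foldRel hN hM (by omega) hG
        (Quotient.exact (s := Γ.foldSetoid) ((hv.trans hclosed).trans hu.symm))
      have h1 := hN _ (freeLabel ω) u (p.append r) (by rw [Walk.length_append]; omega)
      rw [label_append, hr1, mul_one, hplab] at h1
      have h2 := norm_mk_of_isReduced hred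
      rw [h1, FreeGroup.norm_one, List.length_map] at h2
      exact hne (List.length_eq_zero_iff.1 h2.symm)
    · set n := c.steps.length - B * T
      have hwalk := c.isWalk
      rw [← List.take_append_drop n c.steps] at hwalk
      have hdrop : (c.steps.drop n).length = B * T := by
        rw [List.length_drop]; omega
      obtain ⟨u, v, p, -, -, hp, hplab, hpl⟩ := lift _ _ (isWalk_append.1 hwalk).2 (by omega)
      have hred' : FreeGroup.IsReduced ((c.steps.drop n).map Prod.fst) := by
        rw [List.map_drop]
        exact hred.infix (List.drop_suffix _ _).isInfix
      have h1 := N.norm_label_le ω p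
      rw [hplab, norm_mk_of_isReduced hred', List.length_map, hdrop] at h1
      have h2 := hG p hp (by omega) (by omega)
      have h3 : freeProductLength (FreeGroup.mk ((c.steps.drop n).map Prod.fst)) ≤
          freeProductLength c.label := by
        have h4 : c.word = c.word.take n ++ (c.steps.drop n).map Prod.fst := by
          rw [List.map_drop]
          exact (List.take_append_drop n _).symm
        have h5 : FreeGroup.IsReduced c.word := hred
        rw [ReducedPath.label, h4]
        rw [h4] at h5
        exact freeProductLength_mk_le_mk_append _ _ h5
      rw [hplab] at h2
      omega
  have key : ∀ p : Γ.fold.ReducedPath, p.IsPiece → ∀ c : Γ.fold.ReducedPath,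
      c.IsNontrivialCycle →
      (p.label.norm : ℝ) < α * (freeProductLength c.label : ℝ) := by
    intro p hp c hc
    have h1 := hpiece p hp
    have h2 := hcycle c hc
    have h3 : p.label.norm ≤ p.steps.length := by
      have := FreeGroup.norm_mk_le (L₁ := p.word)
      rwa [ReducedPath.word, List.length_map] at this
    have h4 : (p.label.norm : ℝ) < 10 * T := by exact_mod_cast h3.trans_lt h1
    have h5 : (B * T : ℝ) ≤ 2 * freeProductLength c.label := by exact_mod_cast h2
    have hα0 : 0 < α := by
      by_contra hα0
      have : α * B ≤ 0 := mul_nonpos_of_nonpos_of_nonneg (not_lt.1 hα0) (Nat.cast_nonneg B)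
      linarith
    have h6 : α * (B * T) ≤ α * (2 * freeProductLength c.label) :=
      mul_le_mul_of_nonneg_left h5 hα0.le
    have h7 : (20 : ℝ) * T ≤ α * B * T := mul_le_mul_of_nonneg_right hα (Nat.cast_nonneg T)
    nlinarith
  have hα0 : 0 ≤ α := by
    by_contra hα0
    have : α * B ≤ 0 := mul_nonpos_of_nonpos_of_nonneg (not_le.1 hα0).le (Nat.cast_nonneg B)
    linarith
  refine ⟨⟨Γ.fold_isReduced, fun p hp c hc => ?_⟩, ⟨Γ.fold_isReduced, fun p hp c hc => ?_⟩⟩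
  · refine lt_of_le_of_lt ?_ (key p hp c hc)
    exact_mod_cast freeProductLength_le_norm p.label
  · refine (key p hp c hc).trans_le (mul_le_mul_of_nonneg_left ?_ hα0)
    exact_mod_cast freeProductLength_le_norm c.label

end SimpleGraph.EdgeNaming

/-! ### Subdivisions -/

namespace SimpleGraph

/-- On a forest, every labelling of the edges by elements of a group is the coboundary of a
potential. -/
theorem IsAcyclic.exists_potential {V G : Type*} [Group G] {F : SimpleGraph V} (hF : F.IsAcyclic)
    (ℓ : V → V → G) (hℓ : ∀ {u v}, F.Adj u v → ℓ v u = (ℓ u v)⁻¹) :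
    ∃ Φ : V → G, ∀ {u v}, F.Adj u v → Φ v = Φ u * ℓ u v := by
  classical
  have hroot : ∀ v, F.Reachable (F.connectedComponentMk v).out v := fun v =>
    ConnectedComponent.exact (Quot.out_eq _)
  have hpath : ∀ v, ∃ p : F.Walk (F.connectedComponentMk v).out v, p.IsPath := fun v =>
    ⟨(hroot v).some.bypass, (hroot v).some.bypass_isPath⟩
  choose P hP using hpath
  let val : ∀ {x y : V}, F.Walk x y → G := fun p => (p.darts.map fun d => ℓ d.fst d.snd).prod
  have hconcat : ∀ {r u v : V} (p : F.Walk r u) (q : F.Walk r v), p.IsPath → q.IsPath →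
      (h : F.Adj u v) → val q = val p * ℓ u v := by
    intro r u v p q hp hq h
    by_cases hv : v ∈ p.support
    · have := hF.path_concat hq hp h.symm hv
      rw [this]
      simp [val, hℓ h]
    · have hpc : (p.concat h).IsPath := hp.concat hv h
      have := (hF.subsingleton_path r v).elim ⟨q, hq⟩ ⟨p.concat h, hpc⟩
      rw [Subtype.mk.injEq] at this
      rw [this]
      simp [val]
  refine ⟨fun v => val (P v), fun {u v} h => ?_⟩
  have hc : F.connectedComponentMk u = F.connectedComponentMk v :=
    ConnectedComponent.sound h.reachable
  have : ∀ (c : F.ConnectedComponent) (hcu : F.connectedComponentMk v = c)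
      (p : F.Walk c.out u), p.IsPath → val (P v) = val p * ℓ u v := by
    rintro c rfl p hp
    exact hconcat p (P v) hp (hP v) h
  exact this _ hc.symm (P u) (hP u)

end SimpleGraph

section subdivision

variable {V : Type*} (G : SimpleGraph V) {j : ℕ}

theorem subdivPoint_ne_succ (hj : 3 ≤ j) (e : G.edgeSet) {k : ℕ} (hk : k < j) :
    subdivPoint G j e k ≠ subdivPoint G j e (k + 1) := by
  unfold subdivPoint
  split_ifs <;> simp <;> omega

theorem subdivPoint_pair_inj (hj : 3 ≤ j) {e e' : G.edgeSet} {k k' : ℕ} (hk : k < j) (hk' : k' < j)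
    (h : subdivPoint G j e k = subdivPoint G j e' k')
    (h' : subdivPoint G j e (k + 1) = subdivPoint G j e' (k' + 1)) : e = e' ∧ k = k' := by
  unfold subdivPoint at h h'
  split_ifs at h h' <;> try simp only [Sum.inr.injEq, Prod.mk.injEq, Fin.mk.injEq] at h'
  all_goals try simp only [Sum.inr.injEq, Prod.mk.injEq, Fin.mk.injEq] at h
  all_goals first | omega | exact ⟨by tauto, by omega⟩

theorem subdivPoint_pair_ne_swap (hj : 3 ≤ j) {e e' : G.edgeSet} {k k' : ℕ} (hk : k < j)
    (hk' : k' < j) (h : subdivPoint G j e k = subdivPoint G j e' (k' + 1))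
    (h' : subdivPoint G j e (k + 1) = subdivPoint G j e' k') : False := by
  unfold subdivPoint at h h'
  split_ifs at h h' <;> try simp only [Sum.inr.injEq, Prod.mk.injEq, Fin.mk.injEq] at h'
  all_goals try simp only [Sum.inr.injEq, Prod.mk.injEq, Fin.mk.injEq] at h
  all_goals omega

/-- The `j`-subdivision of `G`, as a simple graph. -/
def subdivGraph (j : ℕ) : SimpleGraph (SubdivVertex G j) :=
  SimpleGraph.fromRel fun u v =>
    ∃ (e : G.edgeSet) (k : Fin j), u = subdivPoint G j e k ∧ v = subdivPoint G j e (k + 1)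

variable {G}

theorem subdivGraph_adj_succ (hj : 3 ≤ j) (e : G.edgeSet) (k : Fin j) :
    (subdivGraph G j).Adj (subdivPoint G j e k) (subdivPoint G j e (k + 1)) :=
  (SimpleGraph.fromRel_adj _ _ _).2 ⟨subdivPoint_ne_succ G hj e k.2, Or.inl ⟨e, k, rfl, rfl⟩⟩

theorem subdivGraph_adj {u v : SubdivVertex G j} (h : (subdivGraph G j).Adj u v) :
    ∃ (e : G.edgeSet) (k : Fin j),
      (u = subdivPoint G j e k ∧ v = subdivPoint G j e (k + 1)) ∨
      (u = subdivPoint G j e (k + 1) ∧ v = subdivPoint G j e k) := by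
  obtain ⟨-, ⟨e, k, h1, h2⟩ | ⟨e, k, h1, h2⟩⟩ := (SimpleGraph.fromRel_adj _ _ _).1 h
  · exact ⟨e, k, Or.inl ⟨h1, h2⟩⟩
  · exact ⟨e, k, Or.inr ⟨h2, h1⟩⟩

/-- The signed edge from `u` to `v` in the subdivision; positive if it leads along the path that
contains it. -/
noncomputable def subdivSigned [Nonempty (SubdivEdge G j)] (u v : SubdivVertex G j) :
    SubdivEdge G j × Bool :=
  open Classical in
  if h : ∃ x : SubdivEdge G j, u = subdivPoint G j x.1 x.2 ∧ v = subdivPoint G j x.1 (x.2 + 1) then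
    (h.choose, true)
  else if h : ∃ x : SubdivEdge G j, v = subdivPoint G j x.1 x.2 ∧
      u = subdivPoint G j x.1 (x.2 + 1) then
    (h.choose, false)
  else Classical.arbitrary _

theorem subdivSigned_succ [Nonempty (SubdivEdge G j)] (hj : 3 ≤ j) (e : G.edgeSet) (k : Fin j) :
    subdivSigned (subdivPoint G j e k) (subdivPoint G j e (k + 1)) = ((e, k), true) := by
  have h : ∃ x : SubdivEdge G j, subdivPoint G j e k = subdivPoint G j x.1 x.2 ∧
      subdivPoint G j e (k + 1) = subdivPoint G j x.1 (x.2 + 1) := ⟨(e, k), rfl, rfl⟩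
  rw [subdivSigned, dif_pos h]
  obtain ⟨h1, h2⟩ := subdivPoint_pair_inj G hj k.2 h.choose.2.2 h.choose_spec.1 h.choose_spec.2
  exact Prod.ext (Prod.ext h1.symm (Fin.ext h2.symm)) rfl

theorem subdivSigned_succ_symm [Nonempty (SubdivEdge G j)] (hj : 3 ≤ j) (e : G.edgeSet)
    (k : Fin j) :
    subdivSigned (subdivPoint G j e (k + 1)) (subdivPoint G j e k) = ((e, k), false) := by
  have h0 : ¬ ∃ x : SubdivEdge G j, subdivPoint G j e (k + 1) = subdivPoint G j x.1 x.2 ∧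
      subdivPoint G j e k = subdivPoint G j x.1 (x.2 + 1) :=
    fun ⟨x, h1, h2⟩ => subdivPoint_pair_ne_swap G hj k.2 x.2.2 h2 h1
  have h : ∃ x : SubdivEdge G j, subdivPoint G j e k = subdivPoint G j x.1 x.2 ∧
      subdivPoint G j e (k + 1) = subdivPoint G j x.1 (x.2 + 1) := ⟨(e, k), rfl, rfl⟩
  rw [subdivSigned, dif_neg h0, dif_pos h]
  obtain ⟨h1, h2⟩ := subdivPoint_pair_inj G hj k.2 h.choose.2.2 h.choose_spec.1 h.choose_spec.2
  exact Prod.ext (Prod.ext h1.symm (Fin.ext h2.symm)) rfl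

/-- The edges of the subdivision, named by pairs of an edge of `G` and a number. -/
noncomputable def subdivNaming [Nonempty (SubdivEdge G j)] (hj : 3 ≤ j) :
    (subdivGraph G j).EdgeNaming (SubdivEdge G j) where
  signed := subdivSigned
  signed_symm := by
    intro u v h
    obtain ⟨e, k, ⟨rfl, rfl⟩ | ⟨rfl, rfl⟩⟩ := subdivGraph_adj h <;>
      simp [subdivSigned_succ hj, subdivSigned_succ_symm hj]
  signed_inj := by
    intro u v u' v' h h' heq
    obtain ⟨e, k, ⟨rfl, rfl⟩ | ⟨rfl, rfl⟩⟩ := subdivGraph_adj h <;>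
    obtain ⟨e', k', ⟨rfl, rfl⟩ | ⟨rfl, rfl⟩⟩ := subdivGraph_adj h' <;>
    · simp only [subdivSigned_succ hj, subdivSigned_succ_symm hj, Prod.mk.injEq] at heq
      obtain ⟨rfl, rfl⟩ := heq
      first | rfl | exact Sym2.eq_swap

theorem represents_labeledSubdivision [Nonempty (SubdivEdge G j)] (hj : 3 ≤ j) {m : ℕ}
    (ω : SubdivLabeling G j m) :
    (subdivNaming hj).Represents (freeLabel ω) (labeledSubdivision G j m ω) where
  exists_adj := by
    intro u s v h
    obtain ⟨a, b⟩ := s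
    have hs := subdivSigned_succ (G := G) hj
    have hs' := subdivSigned_succ_symm (G := G) hj
    cases b <;> simp only [LabeledGraph.Step, Bool.false_eq_true, if_false, if_true] at h <;>
    obtain ⟨e, k, ⟨h, rfl, rfl⟩ | ⟨h, rfl, rfl⟩⟩ := h
    · exact ⟨(subdivGraph_adj_succ hj e k).symm, by
        simp [SimpleGraph.EdgeNaming.label_cons, subdivNaming, hs', freeLabel, h,
          LabeledGraph.inv_mk_singleton, -FreeGroup.inv_mk]⟩
    · exact ⟨subdivGraph_adj_succ hj e k, by
        simp [SimpleGraph.EdgeNaming.label_cons, subdivNaming, hs, freeLabel, h]⟩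
    · exact ⟨subdivGraph_adj_succ hj e k, by
        simp [SimpleGraph.EdgeNaming.label_cons, subdivNaming, hs, freeLabel, h]⟩
    · exact ⟨(subdivGraph_adj_succ hj e k).symm, by
        simp [SimpleGraph.EdgeNaming.label_cons, subdivNaming, hs', freeLabel, h,
          LabeledGraph.inv_mk_singleton, -FreeGroup.inv_mk]⟩
  exists_step := by
    intro u v h
    have hs := subdivSigned_succ (G := G) hj
    have hs' := subdivSigned_succ_symm (G := G) hj
    obtain ⟨e, k, ⟨rfl, rfl⟩ | ⟨rfl, rfl⟩⟩ := subdivGraph_adj h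
    · refine ⟨ω (e, k), ?_, by
        simp [SimpleGraph.EdgeNaming.label_cons, subdivNaming, hs, freeLabel]⟩
      rcases hω : ω (e, k) with ⟨a, _ | _⟩
      · exact ⟨e, k, Or.inr ⟨hω, rfl, rfl⟩⟩
      · exact ⟨e, k, Or.inl ⟨hω, rfl, rfl⟩⟩
    · refine ⟨((ω (e, k)).1, !(ω (e, k)).2), ?_, by
        simp [SimpleGraph.EdgeNaming.label_cons, subdivNaming, hs', freeLabel,
          LabeledGraph.inv_mk_singleton, -FreeGroup.inv_mk]⟩
      rcases hω : ω (e, k) with ⟨a, _ | _⟩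
      · exact ⟨e, k, Or.inr ⟨hω, rfl, rfl⟩⟩
      · exact ⟨e, k, Or.inl ⟨hω, rfl, rfl⟩⟩

/-- Closed walks of length less than `j` times the girth are null-homotopic in the `j`-subdivision.
The edges of `G` that such a walk traverses completely form a forest, so that there is a potential
at the old vertices.  It extends to the new vertices: on an edge of `G` that is not traversed
completely, it may jump at a place that the walk omits. -/
theorem subdivNaming_trivialBelow [Nonempty (SubdivEdge G j)] (hj : 3 ≤ j) :
    (subdivNaming (G := G) hj).TrivialBelow (G.girth * j) := by
  classical
  intro Z _ f u p hp
  set N := subdivNaming (G := G) hj with hN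
  set D : Finset (SubdivEdge G j) := ((N.trace p).map Prod.fst).toFinset with hD
  have hDcard : D.card < G.girth * j := by
    refine lt_of_le_of_lt (List.toFinset_card_le _) ?_
    simpa using hp
  set F : Finset G.edgeSet := (D.image Prod.fst).filter fun e => ∀ k, (e, k) ∈ D with hF
  have hmemF : ∀ e, e ∈ F ↔ ∀ k, (e, k) ∈ D := by
    intro e
    simp only [hF, Finset.mem_filter, Finset.mem_image, and_iff_right_iff_imp]
    intro h
    exact ⟨(e, ⟨0, by omega⟩), h _, rfl⟩
  have hFcard : F.card < G.girth := by
    have h1 : (F ×ˢ (Finset.univ : Finset (Fin j))).card ≤ D.card := by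
      refine Finset.card_le_card fun x hx => ?_
      rw [Finset.mem_product] at hx
      exact (hmemF x.1).1 hx.1 x.2
    rw [Finset.card_product, Finset.card_univ, Fintype.card_fin] at h1
    exact lt_of_mul_lt_mul_right (h1.trans_lt hDcard) (Nat.zero_le j)
  set T : SimpleGraph V :=
    SimpleGraph.fromEdgeSet {e | ∃ h : e ∈ G.edgeSet, (⟨e, h⟩ : G.edgeSet) ∈ F}
    with hT
  have hTG : T ≤ G := by
    intro x y hxy
    obtain ⟨⟨h, -⟩, -⟩ := (SimpleGraph.fromEdgeSet_adj _).1 hxy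
    exact h
  have hacyc : T.IsAcyclic := by
    intro x c hc
    have h1 : c.edges.toFinset.card ≤ (F.map (Function.Embedding.subtype _)).card := by
      refine Finset.card_le_card fun e he => ?_
      rw [List.mem_toFinset] at he
      have he' := c.edges_subset_edgeSet he
      rw [hT, SimpleGraph.edgeSet_fromEdgeSet] at he'
      obtain ⟨⟨h, hF'⟩, -⟩ := he'
      exact Finset.mem_map.2 ⟨⟨e, h⟩, hF', rfl⟩
    rw [List.toFinset_card_of_nodup hc.edges_nodup, SimpleGraph.Walk.length_edges,
      Finset.card_map] at h1
    have h2 := (hc.mapLe hTG).isCircuit.girth_le_length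
    simp at h2
    omega
  set g : G.edgeSet → ℕ → Z := fun e i => if h : i < j then f (e, ⟨i, h⟩) else 1 with hg
  set P : G.edgeSet → ℕ → Z := fun e k => ((List.range k).map (g e)).prod with hP
  have hPsucc : ∀ e k, P e (k + 1) = P e k * g e k := fun e k => List.prod_range_succ _ _
  have hP0 : ∀ e, P e 0 = 1 := fun e => rfl
  have hout : ∀ e : Sym2 V, s(e.out.1, e.out.2) = e := fun e => Quot.out_eq e
  obtain ⟨Φ, hΦ⟩ := hacyc.exists_potential
    (fun x y => if h : s(x, y) ∈ G.edgeSet then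
      if x = (Quot.out s(x, y)).1 then P ⟨_, h⟩ j else (P ⟨_, h⟩ j)⁻¹ else 1) (by
    intro x y hxy
    have hG : s(x, y) ∈ G.edgeSet := hTG hxy
    have hG' : s(y, x) ∈ G.edgeSet := hTG hxy.symm
    have hswap : s(y, x) = s(x, y) := Sym2.eq_swap
    simp only [hswap, dif_pos hG]
    have h1 := hout s(x, y)
    have hne : x ≠ y := hxy.ne
    rw [Sym2.eq_iff] at h1
    rcases h1 with ⟨h1, h2⟩ | ⟨h1, h2⟩
    · rw [if_neg (by rw [h1]; exact hne.symm), if_pos h1.symm]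
    · rw [if_pos h1.symm, if_neg (by rw [h1]; exact hne), inv_inv])
  have hΦF : ∀ e ∈ F, Φ (Quot.out e.1).2 = Φ (Quot.out e.1).1 * P e j := by
    rintro ⟨e, he⟩ heF
    have h1 := hout e
    have hadjG : G.Adj (Quot.out e).1 (Quot.out e).2 := by
      rw [← SimpleGraph.mem_edgeSet, h1]; exact he
    have hadj : T.Adj (Quot.out e).1 (Quot.out e).2 := by
      refine (SimpleGraph.fromEdgeSet_adj _).2 ⟨?_, hadjG.ne⟩
      rw [h1]
      exact ⟨he, heF⟩
    rw [hΦ hadj]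
    simp only [h1, dif_pos he, if_true]
  -- The value of the potential at the `k`-th point of the path that replaces `e`.
  set ψ : G.edgeSet → ℕ → Z := fun e k =>
    if ∀ i : Fin j, (i : ℕ) < k → (e, i) ∈ D then Φ (Quot.out e.1).1 * P e k
    else Φ (Quot.out e.1).2 * (P e j)⁻¹ * P e k with hψ
  set φ : SubdivVertex G j → Z := Sum.elim Φ fun x => ψ x.1 (x.2 + 1) with hφ
  have hφψ : ∀ e k, k ≤ j → φ (subdivPoint G j e k) = ψ e k := by
    intro e k hk
    unfold subdivPoint
    split_ifs with h0 h1
    · subst h0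
      simp [hφ, hψ, hP0]
    · simp only [hφ, Sum.elim_inr]
      congr 1
      omega
    · obtain rfl : k = j := by omega
      simp only [hφ, Sum.elim_inl, hψ]
      split_ifs with hfull
      · exact hΦF e ((hmemF e).2 fun i => hfull i i.2)
      · rw [inv_mul_cancel_right]
  have hstep : ∀ (e : G.edgeSet) (k : Fin j), (e, k) ∈ D →
      φ (subdivPoint G j e (k + 1)) = φ (subdivPoint G j e k) * f (e, k) := by
    intro e k hk
    rw [hφψ e _ k.2, hφψ e _ k.2.le]
    have hgk : g e k = f (e, k) := by simp [hg]
    have hiff : (∀ i : Fin j, (i : ℕ) < k + 1 → (e, i) ∈ D) ↔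
        ∀ i : Fin j, (i : ℕ) < k → (e, i) ∈ D := by
      refine ⟨fun h i hi => h i (by omega), fun h i hi => ?_⟩
      rcases Nat.lt_succ_iff_lt_or_eq.1 hi with hi | hi
      · exact h i hi
      · rwa [Fin.ext hi]
    simp only [hψ, hiff, hPsucc, hgk]
    split_ifs <;> simp only [mul_assoc]
  have hwalk : ∀ {x y : SubdivVertex G j} (q : (subdivGraph G j).Walk x y),
      (∀ e ∈ (N.trace q).map Prod.fst, e ∈ D) → φ y = φ x * N.label f q := by
    intro x y q
    induction q with
    | nil => simp
    | @cons x z y h q ih =>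
      intro hq
      have hq1 := hq (N.signed x z).1 (by simp [SimpleGraph.EdgeNaming.trace])
      have hq2 := ih fun e he => hq e (by
        simp only [SimpleGraph.EdgeNaming.trace, SimpleGraph.Walk.darts_cons, List.map_cons,
          List.mem_cons] at he ⊢
        exact Or.inr he)
      rw [hq2, SimpleGraph.EdgeNaming.label_cons, ← mul_assoc]
      congr 1
      have hsig : ∀ x z, N.signed x z = subdivSigned x z := fun _ _ => rfl
      obtain ⟨e, k, ⟨rfl, rfl⟩ | ⟨rfl, rfl⟩⟩ := subdivGraph_adj h
      · rw [hsig, subdivSigned_succ hj] at hq1 ⊢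
        simpa using hstep e k hq1
      · rw [hsig, subdivSigned_succ_symm hj] at hq1 ⊢
        simpa [eq_mul_inv_iff_mul_eq] using (hstep e k hq1).symm
  have := hwalk p fun e he => by simpa [hD] using he
  exact (mul_eq_left.1 this.symm)

end subdivision

/-! ### The exceptional labellings -/

section probability

variable {V : Type*} [Finite V] {G : SimpleGraph V} {j : ℕ}

/-- The union bound over the pairs and quadruples of endpoints of the paths that can have an
exceptional label. -/
theorem one_sub_le_probGrStarAndGr [Nonempty (SubdivEdge G j)] (hj : 3 ≤ j) {m : ℕ} (hm : 64 < m)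
    {T B : ℕ} (hB : 10 ≤ B) (hT : 1 ≤ T) (hM : 2 * ((2 * B + 2) * T) < G.girth * j) {α : ℝ}
    (hα : 20 ≤ α * B) :
    1 - 2 * (Nat.card (SubdivVertex G j) : ℝ) ^ 4 * (2 / 3) ^ T ≤ probGrStarAndGr G j m α := by
  classical
  have := Fintype.ofFinite (SubdivVertex G j)
  have := Fintype.ofFinite (SubdivEdge G j)
  have : NeZero m := ⟨by omega⟩
  set N := subdivNaming (G := G) hj
  have hN : N.TrivialBelow (G.girth * j) := subdivNaming_trivialBelow hj
  have hBT : 10 * T ≤ B * T := Nat.mul_le_mul_right T hB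
  have hRT : (2 * B + 2) * T = 2 * (B * T) + 2 * T := by ring
  let X₁ : SubdivVertex G j × SubdivVertex G j → Set (SubdivLabeling G j m) := fun x =>
    {ω | ∃ p : (subdivGraph G j).Walk x.1 x.2, p.IsPath ∧ T < p.length ∧
      p.length ≤ (2 * B + 2) * T ∧
      2 * LabeledGraph.freeProductLength (N.label (freeLabel ω) p) < p.length}
  let X₂ : (SubdivVertex G j × SubdivVertex G j) × (SubdivVertex G j × SubdivVertex G j) →
      Set (SubdivLabeling G j m) := fun x =>
    {ω | ∃ (p : (subdivGraph G j).Walk x.1.1 x.1.2) (q : (subdivGraph G j).Walk x.2.1 x.2.2),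
      p.IsPath ∧ q.IsPath ∧ 10 * T ≤ p.length ∧ p.length ≤ 20 * T ∧ q.length ≤ 20 * T ∧
      N.label (freeLabel ω) p = N.label (freeLabel ω) q ∧
      ∀ r : (subdivGraph G j).Walk x.1.1 x.2.1, N.label (freeLabel ω) r ≠ 1}
  -- Short paths are determined by their endpoints, so that each of these events concerns the
  -- labels of at most one path, or pair of paths.
  have h₁ : ∀ x, uniformProb _ (X₁ x) ≤ (2 / 3) ^ T := by
    intro x
    by_cases hx : ∃ p : (subdivGraph G j).Walk x.1 x.2, p.IsPath ∧ T < p.length ∧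
      p.length ≤ (2 * B + 2) * T
    · obtain ⟨p, hp, hpT, hpR⟩ := hx
      refine (uniformProb_mono ?_).trans
        (N.uniformProb_label_short_le hm p hp.edges_nodup hpT.le)
      rintro ω ⟨q, hq, hqT, hqR, hω⟩
      rwa [hN.path_unique q p hq hp (by omega)] at hω
    · have : X₁ x = ∅ := by
        ext ω
        simp only [Set.mem_empty_iff_false, iff_false]
        rintro ⟨q, hq, hqT, hqR, -⟩
        exact hx ⟨q, hq, hqT, hqR⟩
      rw [this]
      simp only [uniformProb, Set.ncard_empty, Nat.cast_zero, zero_div]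
      positivity
  have h₂ : ∀ x, uniformProb _ (X₂ x) ≤ (2 / 3) ^ T := by
    intro x
    by_cases hx : ∃ (p : (subdivGraph G j).Walk x.1.1 x.1.2)
        (q : (subdivGraph G j).Walk x.2.1 x.2.2), p.IsPath ∧ q.IsPath ∧ 10 * T ≤ p.length ∧
        p.length ≤ 20 * T ∧ q.length ≤ 20 * T
    · obtain ⟨p, q, hp, hq, hpT, hpR, hqR⟩ := hx
      refine (uniformProb_mono ?_).trans
        ((hN.uniformProb_label_eq_le hm p q hp hq hpT (by omega)).trans
          (pow_le_pow_left₀ (by norm_num) (by norm_num) T))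
      rintro ω ⟨p', q', hp', hq', -, hpR', hqR', hω⟩
      rwa [hN.path_unique p' p hp' hp (by omega), hN.path_unique q' q hq' hq (by omega)] at hω
    · have : X₂ x = ∅ := by
        ext ω
        simp only [Set.mem_empty_iff_false, iff_false]
        rintro ⟨p, q, hp, hq, hpT, hpR, hqR, -⟩
        exact hx ⟨p, q, hp, hq, hpT, hpR, hqR⟩
      rw [this]
      simp only [uniformProb, Set.ncard_empty, Nat.cast_zero, zero_div]
      positivity
  have hgood : ((⋃ x, X₁ x) ∪ ⋃ x, X₂ x)ᶜ ⊆ {ω | (labeledSubdivision G j m ω).fold.GrStar α ∧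
      (labeledSubdivision G j m ω).fold.Gr α} := by
    intro ω hω
    simp only [Set.mem_compl_iff, Set.mem_union, Set.mem_iUnion, not_or, not_exists] at hω
    refine (represents_labeledSubdivision hj ω).gr_fold hN hB hT hM hα ?_ ?_
    · intro u v p hp hpT hpR
      by_contra hlt
      exact hω.1 (u, v) ⟨p, hp, hpT, hpR, not_le.1 hlt⟩
    · intro u v u' v' p q hp hq hpT hpR hqR heq
      by_contra hr
      rw [not_exists] at hr
      exact hω.2 ((u, v), (u', v')) ⟨p, q, hp, hq, hpT, hpR, hqR, heq, hr⟩
  have hW : (1 : ℝ) ≤ Nat.card (SubdivVertex G j) := by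
    obtain ⟨e, k⟩ := Classical.arbitrary (SubdivEdge G j)
    have : Nonempty (SubdivVertex G j) := ⟨subdivPoint G j e k⟩
    exact_mod_cast Nat.card_pos
  calc 1 - 2 * (Nat.card (SubdivVertex G j) : ℝ) ^ 4 * (2 / 3) ^ T
      ≤ 1 - uniformProb _ ((⋃ x, X₁ x) ∪ ⋃ x, X₂ x) := by
        have h3 := uniformProb_union_le (⋃ x, X₁ x) (⋃ x, X₂ x)
        have h4 := uniformProb_iUnion_le X₁ _ h₁
        have h5 := uniformProb_iUnion_le X₂ _ h₂
        rw [Fintype.card_prod] at h4 h5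
        rw [Fintype.card_prod] at h5
        rw [← Nat.card_eq_fintype_card] at h4 h5
        push_cast at h4 h5
        set n : ℝ := (Nat.card (SubdivVertex G j) : ℝ)
        have hn : n * n ≤ n ^ 4 := by
          rw [← pow_two]
          exact pow_le_pow_right₀ hW (by norm_num)
        have h6 : n * n * (2 / 3 : ℝ) ^ T ≤ n ^ 4 * (2 / 3) ^ T :=
          mul_le_mul_of_nonneg_right hn (by positivity)
        have h7 : n * n * (n * n) * (2 / 3 : ℝ) ^ T = n ^ 4 * (2 / 3) ^ T := by ring
        linarith
    _ = uniformProb _ ((⋃ x, X₁ x) ∪ ⋃ x, X₂ x)ᶜ := (uniformProb_compl _).symm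
    _ ≤ probGrStarAndGr G j m α := uniformProb_mono hgood

end probability

/-! ### The number of vertices -/

theorem SimpleGraph.ncard_setOf_walk_length_le {V : Type*} [Finite V] (G : SimpleGraph V) (d : ℕ)
    (hd : ∀ v, (G.neighborSet v).ncard ≤ d) (u : V) (n : ℕ) :
    {v | ∃ p : G.Walk v u, p.length ≤ n}.ncard ≤ (d + 1) ^ n := by
  classical
  induction n with
  | zero =>
    rw [pow_zero, Set.ncard_le_one_iff]
    rintro v w ⟨p, hp⟩ ⟨q, hq⟩
    rw [SimpleGraph.Walk.eq_of_length_eq_zero (Nat.le_zero.1 hp),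
      SimpleGraph.Walk.eq_of_length_eq_zero (Nat.le_zero.1 hq)]
  | succ n ih =>
    set S := {v | ∃ p : G.Walk v u, p.length ≤ n} with hS
    have := Fintype.ofFinite V
    have hsub : {v | ∃ p : G.Walk v u, p.length ≤ n + 1} ⊆
        ⋃ w ∈ S.toFinset, insert w (G.neighborSet w) := by
      rintro v ⟨p, hp⟩
      simp only [Set.mem_toFinset, Set.mem_iUnion]
      cases p with
      | nil => exact ⟨u, ⟨.nil, by simp⟩, Set.mem_insert _ _⟩
      | @cons _ w _ h p =>
        rw [SimpleGraph.Walk.length_cons] at hp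
        exact ⟨w, ⟨p, by omega⟩, Set.mem_insert_of_mem _ h.symm⟩
    refine (Set.ncard_le_ncard hsub).trans ((Finset.set_ncard_biUnion_le _ _).trans ?_)
    refine (Finset.sum_le_card_nsmul _ _ (d + 1) fun w _ => ?_).trans ?_
    · exact (Set.ncard_insert_le _ _).trans (Nat.succ_le_succ (hd w))
    · rw [← Set.ncard_eq_toFinset_card', smul_eq_mul, pow_succ]
      exact Nat.mul_le_mul_right _ ih

theorem SimpleGraph.Connected.card_le_pow_diam {V : Type*} [Finite V] {G : SimpleGraph V}
    (hG : G.Connected) (d : ℕ) (hd : ∀ v, (G.neighborSet v).ncard ≤ d) :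
    Nat.card V ≤ (d + 1) ^ G.diam := by
  have := hG.nonempty
  obtain ⟨u⟩ := hG.nonempty
  have h := G.ncard_setOf_walk_length_le d hd u G.diam
  have huniv : {v | ∃ p : G.Walk v u, p.length ≤ G.diam} = Set.univ := by
    ext v
    simp only [Set.mem_univ, iff_true]
    obtain ⟨p, hp⟩ := hG.exists_walk_length_eq_dist v u
    exact ⟨p, hp.trans_le (SimpleGraph.dist_le_diam
      (SimpleGraph.connected_iff_ediam_ne_top.1 hG))⟩
  rwa [huniv, Set.ncard_univ] at h

theorem card_subdivVertex_le {V : Type*} [Finite V] [Nonempty V] (G : SimpleGraph V) {j : ℕ}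
    (hj : 1 ≤ j) : Nat.card (SubdivVertex G j) ≤ Nat.card V ^ 2 * j := by
  have hE : Nat.card G.edgeSet ≤ Nat.card V ^ 2 := by
    rw [pow_two, ← Nat.card_prod]
    refine Nat.card_le_card_of_injective (fun e : G.edgeSet => Quot.out e.1) fun e e' h => ?_
    exact Subtype.ext
      ((Quot.out_eq e.1).symm.trans ((congrArg _ h).trans (Quot.out_eq e'.1)))
  rw [Nat.card_sum, Nat.card_prod, Nat.card_fin]
  obtain ⟨k, rfl⟩ : ∃ k, j = k + 1 := ⟨j - 1, by omega⟩
  have hV : Nat.card V ≤ Nat.card V ^ 2 := Nat.le_self_pow two_ne_zero _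
  have := Nat.mul_le_mul_right k hE
  rw [Nat.add_sub_cancel, mul_add, mul_one]
  omega

/-! ### The probability in terms of the girth -/

theorem IsSelbergFamily.probGrStarAndGr_ge {m : ℕ} (hm : 64 < m) {d : ℕ} {C α : ℝ} {B j : ℕ}
    (hB : 10 ≤ B) (hα : 20 ≤ α * B) (hj : 4 * B + 5 ≤ j) {V : ℕ → Type*}
    {S : ∀ i, SimpleGraph (V i)} (hS : IsSelbergFamily d C S) (i : ℕ) :
    1 - 2 * (j : ℝ) ^ 4 * Real.exp (-((j / (4 * B + 5) : ℕ) * Real.log (3 / 2) -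
      8 * C * Real.log (d + 1)) * ((S i).girth : ℝ)) ≤ probGrStarAndGr (S i) j m α := by
  set g := (S i).girth with hg
  have hj1 : (1 : ℝ) ≤ j := by exact_mod_cast (by omega : 1 ≤ j)
  rcases Nat.eq_zero_or_pos g with hg0 | hg0
  · -- The girth of a forest is `0` by convention; the bound is then trivial.
    have h0 : 0 ≤ probGrStarAndGr (S i) j m α := uniformProb_nonneg _
    have h1 : (1 : ℝ) ≤ (j : ℝ) ^ 4 := one_le_pow₀ hj1
    rw [hg0, Nat.cast_zero, mul_zero, Real.exp_zero]
    linarith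
  have := hS.finite i
  have hconn := hS.connected i
  have := hconn.nonempty
  have hne : Nonempty (SubdivEdge (S i) j) := by
    obtain ⟨v⟩ := hconn.nonempty
    have h3 := hS.three_le_degree i v
    obtain ⟨w, hw⟩ := Set.nonempty_of_ncard_ne_zero (by omega : ((S i).neighborSet v).ncard ≠ 0)
    exact ⟨(⟨s(v, w), hw⟩, ⟨0, by omega⟩)⟩
  set t := j / (4 * B + 5) with ht
  have ht1 : 1 ≤ t := Nat.div_pos hj (by omega)
  have htj : (4 * B + 5) * t ≤ j := Nat.mul_div_le j _
  have hT : 1 ≤ t * g := Nat.mul_pos ht1 hg0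
  have hM : 2 * ((2 * B + 2) * (t * g)) < g * j := by
    have h1 := Nat.mul_le_mul_right g htj
    nlinarith
  refine le_trans ?_ (one_sub_le_probGrStarAndGr (by omega) hm hB hT hM hα)
  have hcard : (Nat.card (SubdivVertex (S i) j) : ℝ) ^ 4 ≤
      (j : ℝ) ^ 4 * Real.exp (8 * C * Real.log (d + 1) * g) := by
    have h1 := card_subdivVertex_le (S i) (by omega : 1 ≤ j)
    have h2 := hconn.card_le_pow_diam d (hS.degree_le i)
    have h3 : (Nat.card (SubdivVertex (S i) j) : ℝ) ≤ ((d + 1 : ℝ) ^ (S i).diam) ^ 2 * j := by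
      have h1' : (Nat.card (SubdivVertex (S i) j) : ℝ) ≤ (Nat.card (V i) : ℝ) ^ 2 * j := by
        exact_mod_cast h1
      refine h1'.trans ?_
      gcongr
      exact_mod_cast h2
    have h4 : (1 : ℝ) ≤ d + 1 := by linarith [(Nat.cast_nonneg d : (0 : ℝ) ≤ d)]
    have h5 : 0 ≤ Real.log (d + 1) := Real.log_nonneg h4
    have h6 : (d + 1 : ℝ) ^ (S i).diam = Real.exp ((S i).diam * Real.log (d + 1)) := by
      rw [Real.exp_nat_mul, Real.exp_log (by linarith)]
    calc (Nat.card (SubdivVertex (S i) j) : ℝ) ^ 4 ≤ (((d + 1 : ℝ) ^ (S i).diam) ^ 2 * j) ^ 4 := by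
          gcongr
      _ = (j : ℝ) ^ 4 * Real.exp (8 * ((S i).diam * Real.log (d + 1))) := by
          rw [h6, ← Real.exp_nat_mul, mul_pow, ← Real.exp_nat_mul]
          push_cast
          ring_nf
      _ ≤ _ := by
          refine mul_le_mul_of_nonneg_left (Real.exp_le_exp.2 ?_) (by positivity)
          have := mul_le_mul_of_nonneg_right (hS.diam_le i) h5
          rw [← hg] at this
          nlinarith
  have hpow : (2 / 3 : ℝ) ^ (t * g) = Real.exp (-((t : ℝ) * Real.log (3 / 2) * g)) := by
    have : (2 / 3 : ℝ) = Real.exp (-Real.log (3 / 2)) := by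
      rw [Real.exp_neg, Real.exp_log (by norm_num)]; norm_num
    rw [this, ← Real.exp_nat_mul]
    push_cast
    ring_nf
  rw [hpow]
  have hsplit : Real.exp (-((t : ℝ) * Real.log (3 / 2) - 8 * C * Real.log (d + 1)) * g) =
      Real.exp (8 * C * Real.log (d + 1) * g) * Real.exp (-((t : ℝ) * Real.log (3 / 2) * g)) := by
    rw [← Real.exp_add]
    ring_nf
  rw [hsplit]
  have := mul_le_mul_of_nonneg_right hcard (Real.exp_pos (-((t : ℝ) * Real.log (3 / 2) * g))).le
  linarith

theorem theoremA10 (m : ℕ) (hm : 64 < m) (d : ℕ) (C : ℝ) (hC : 1 < C) (α : ℝ) (hα : 0 < α) :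
    ∃ j₀ : ℕ, 0 < j₀ ∧ ∀ j : ℕ, j₀ < j →
      ∃ a b : ℝ, 0 < a ∧ 0 < b ∧
        ∀ (V : ℕ → Type*) (S : ∀ i, SimpleGraph (V i)), IsSelbergFamily d C S →
          Filter.Tendsto (fun i => probGrStarAndGr (S i) j m α) Filter.atTop (nhds 1) ∧
          ∀ i, 1 - a * Real.exp (-b * ((S i).girth : ℝ)) ≤ probGrStarAndGr (S i) j m α := by
  set B : ℕ := max 10 ⌈20 / α⌉₊ with hB
  have hBα : 20 ≤ α * B := by
    have h1 : (20 / α : ℝ) ≤ B := (Nat.le_ceil _).trans (by exact_mod_cast le_max_right _ _)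
    rwa [div_le_iff₀' hα] at h1
  have hlog : 0 < Real.log (3 / 2) := Real.log_pos (by norm_num)
  -- If `j` is at least `(4 * B + 5) * κ`, the exceptional events are so unlikely as to outweigh the
  -- number of quadruples of vertices.
  set κ : ℕ := ⌈8 * C * Real.log (d + 1) / Real.log (3 / 2)⌉₊ + 1 with hκ
  refine ⟨(4 * B + 5) * κ, by positivity, fun j hj => ?_⟩
  have hκj : κ ≤ j / (4 * B + 5) :=
    (Nat.le_div_iff_mul_le (by omega)).2 (by rw [mul_comm]; exact hj.le)
  have hb : 0 < (j / (4 * B + 5) : ℕ) * Real.log (3 / 2) - 8 * C * Real.log (d + 1) := by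
    have h1 : 8 * C * Real.log (d + 1) / Real.log (3 / 2) < κ := by
      rw [hκ, Nat.cast_add, Nat.cast_one]
      exact (Nat.le_ceil _).trans_lt (lt_add_one _)
    have h2 : (κ : ℝ) ≤ (j / (4 * B + 5) : ℕ) := by exact_mod_cast hκj
    have h3 := h1.trans_le h2
    rw [div_lt_iff₀ hlog] at h3
    linarith
  have hj5 : 4 * B + 5 ≤ j :=
    (Nat.le_mul_of_pos_right _ (Nat.succ_pos _)).trans hj.le
  have hj0 : (0 : ℝ) < j := by exact_mod_cast (by omega : 0 < j)
  refine ⟨2 * (j : ℝ) ^ 4, _, by positivity, hb, fun V S hS => ?_⟩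
  have hbound := hS.probGrStarAndGr_ge hm (le_max_left 10 _) hBα hj5
  refine ⟨?_, hbound⟩
  refine tendsto_of_tendsto_of_tendsto_of_le_of_le ?_ tendsto_const_nhds hbound fun i => ?_
  · have h1 : Filter.Tendsto (fun i => ((S i).girth : ℝ)) Filter.atTop Filter.atTop :=
      tendsto_natCast_atTop_atTop.comp hS.girth_tendsto
    have h2 := Real.tendsto_exp_neg_atTop_nhds_zero.comp (h1.const_mul_atTop hb)
    have h3 := (h2.const_mul (2 * (j : ℝ) ^ 4)).const_sub 1
    rw [mul_zero, sub_zero] at h3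
    refine h3.congr fun i => ?_
    rw [Function.comp_apply, neg_mul]
  · have := hS.finite i
    exact uniformProb_le_one _
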